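/- Let $\Delta=-\sum_{i=1}^n\partial_i^2$ on $\mathbb R^n$ and $\mathrm{Diag}=\{(x,y)\in\mathbb R^n\times\mathbb R^n : x=y\}$. Let $k\ge 1$ and $n>2k$ be integers. For $x\ne y$ put $$G_1^{(1)}(x,y)=(2\pi)^{-n/2}|x-y|^{-\frac{n-2}{2}}K_{\frac{n-2}{2}}(|x-y|),\qquad G_1^{(j+1)}(x,y)=\int_{\mathbb R^n}G_1^{(j)}(x,z)\,G_1^{(1)}(z,y)\,dz\quad(1\le j<k),$$ where $K_\nu(r)=\int_0^\infty e^{-r\cosh t}\cosh(\nu t)\,dt$ $(r>0)$ is the modified Bessel function of the second kind, and for $\alpha>0$ put $$G_\alpha^{(k)}(x,y)=\alpha^{\frac{n-2k}{2}}\,G_1^{(k)}(\sqrt\alpha\,x,\sqrt\alpha\,y).$$ A function $G:\mathbb R^n\times\mathbb R^n\setminus\mathrm{Diag}\to\mathbb R$ is a *fundamental solution* (Green's function) of $(\Delta+\alpha)^k$ in $\mathbb R^n$ if for every $x\in\mathbb R^n$ one has $G(x,\cdot)\in L^1_{loc}(\mathbb R^n)$ and $\int_{\mathbb R^n}G(x,y)\,(\Delta+\alpha)^k\varphi(y)\,dy=\varphi(x)$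 for all $\varphi\in C_c^\infty(\mathbb R^n)$. Let $\mathfrak H_k$ be the set of all $u\in C^{2k}(\mathbb R^n\times\mathbb R^n\setminus\mathrm{Diag})$ such that (i) there is $C>0$ with $|u(x,y)|\le C|x-y|^{-(n-2k)}$ whenever $0<|x-y|\le 1$, and (ii) for every $p\ge 1$ there is $C_p>0$ with $|\nabla_y^l u(x,y)|\le C_p|x-y|^{-p}$ for all $l=0,\dots,2k$ whenever $|x-y|\ge 1$. **Theorem.** The integrals defining $G_1^{(j+1)}(x,y)$, $1\le j<k$, $x\neq y$, converge absolutely, and the following holds. 1. For every $\alpha>0$, $G_\alpha^{(k)}$ is a fundamental solution of $(\Delta+\alpha)^k$ in $\mathbb R^n$ that belongs to $\mathfrak H_k$, and it is the only one: every fundamental solution of $(\Delta+\alpha)^k$ in $\mathfrak H_k$ coincides with $G_\alpha^{(k)}$ on $\mathbb R^n\times\mathbb R^n\setminus\mathrm{Diag}$. 2. There is a constant $C>0$, depending only on $n$ and $k$ and not on $\alpha$, such that for all $\alpha>0$ and all $x\ne y$ in $\mathbb R^n$, $$G_\alpha^{(k)}(x,y)\le\begin{cases}C\,|x-y|^{2k-n}&\text{if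 }\sqrt\alpha\,|x-y|\le 1,\\[2pt] C\,\alpha^{k\frac{n-3}{4}}\,|x-y|^{\frac{(k-2)n+k}{2}}\,e^{-\sqrt\alpha\,|x-y|}&\text{if }\sqrt\alpha\,|x-y|\ge 1.\end{cases}$$ 3. For every $\alpha>0$, $G_\alpha^{(k)}$ is radial: $G_\alpha^{(k)}(x,y)$, $x\neq y$, depends only on $|x-y|$. -/

import Mathlib

/-- The modified Bessel function of the second kind `K_ν`, at `r > 0`, given by
`K_ν(r) = ∫_0^∞ e^{-r cosh t} cosh(ν t) dt`. -/
noncomputable def besselK (ν r : ℝ) : ℝ :=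
  ∫ t in Set.Ioi (0 : ℝ), Real.exp (-(r * Real.cosh t)) * Real.cosh (ν * t)

/-- `(Δ + α)^k φ`, where `Δ = -∑ ∂_i²` is the nonnegative Laplacian of `ℝⁿ`
(Mathlib's `Laplacian.laplacian` is `∑ ∂_i²`). -/
noncomputable def polyOp {n : ℕ} (α : ℝ) (k : ℕ) (φ : EuclideanSpace ℝ (Fin n) → ℝ) :
    EuclideanSpace ℝ (Fin n) → ℝ :=
  (fun (f : EuclideanSpace ℝ (Fin n) → ℝ) (y : EuclideanSpace ℝ (Fin n)) =>
    -((Laplacian.laplacian f : EuclideanSpace ℝ (Fin n) → ℝ) y) + α * f y)^[k] φ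

/-- `G` is a fundamental solution (Green's function) of `(Δ + α)^k` on `ℝⁿ`.
A function on `ℝⁿ × ℝⁿ ∖ Diag` is represented by a function of two variables whose values on
the diagonal are irrelevant (they do not affect this definition). -/
def IsFundamentalSolution {n : ℕ} (α : ℝ) (k : ℕ)
    (G : EuclideanSpace ℝ (Fin n) → EuclideanSpace ℝ (Fin n) → ℝ) : Prop :=
  ∀ x : EuclideanSpace ℝ (Fin n),
    MeasureTheory.LocallyIntegrable (G x) MeasureTheory.volume ∧
    ∀ φ : EuclideanSpace ℝ (Fin n) → ℝ, ContDiff ℝ (⊤ : ℕ∞) φ → HasCompactSupport φ →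
      ∫ y, G x y * polyOp α k φ y = φ x

/-- The class `𝔥_k`: functions of class `C^{2k}` on `ℝⁿ × ℝⁿ ∖ Diag` which are
`O(|x-y|^{-(n-2k)})` for `|x-y| ≤ 1`, and all of whose derivatives in `y` of order at most `2k`
decay faster than any power of `|x-y|` for `|x-y| ≥ 1`, uniformly in `x` and `y`. -/
structure InClassH {n : ℕ} (k : ℕ)
    (u : EuclideanSpace ℝ (Fin n) → EuclideanSpace ℝ (Fin n) → ℝ) : Prop where
  contDiffOn : ContDiffOn ℝ ((2 * k : ℕ) : WithTop ℕ∞)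
    (fun p : EuclideanSpace ℝ (Fin n) × EuclideanSpace ℝ (Fin n) => u p.1 p.2)
    {p | p.1 ≠ p.2}
  near : ∃ C : ℝ, 0 < C ∧ ∀ x y : EuclideanSpace ℝ (Fin n), x ≠ y → ‖x - y‖ ≤ 1 →
    |u x y| ≤ C * ‖x - y‖ ^ (-((n : ℝ) - 2 * (k : ℝ)))
  far : ∀ p : ℝ, 1 ≤ p → ∃ C : ℝ, 0 < C ∧ ∀ l : ℕ, l ≤ 2 * k →
    ∀ x y : EuclideanSpace ℝ (Fin n), 1 ≤ ‖x - y‖ →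
      ‖iteratedFDeriv ℝ l (u x) y‖ ≤ C * ‖x - y‖ ^ (-p)

/-- The Bessel kernel `(2π)^{-n/2} |x-y|^{-(n-2)/2} K_{(n-2)/2}(|x-y|)`. -/
noncomputable def besselKernel (n : ℕ) (x y : EuclideanSpace ℝ (Fin n)) : ℝ :=
  (2 * Real.pi) ^ (-((n : ℝ) / 2)) * ‖x - y‖ ^ (-(((n : ℝ) - 2) / 2)) *
    besselK (((n : ℝ) - 2) / 2) ‖x - y‖

/-- The iterated convolutions `G_1^{(k)}`, `k ≥ 1`: `G_1^{(1)}` is the Bessel kernel and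
`G_1^{(k+1)}(x,y) = ∫ G_1^{(k)}(x,z) G_1^{(1)}(z,y) dz`. The value at `k = 0` is a dummy. -/
noncomputable def greenOne (n : ℕ) :
    ℕ → EuclideanSpace ℝ (Fin n) → EuclideanSpace ℝ (Fin n) → ℝ
  | 0 => fun _ _ => 0
  | 1 => besselKernel n
  | (k + 2) => fun x y => ∫ z, greenOne n (k + 1) x z * besselKernel n z y

/-- `G_α^{(k)}(x,y) = α^{(n-2k)/2} G_1^{(k)}(√α x, √α y)`. -/
noncomputable def greenAlpha (n k : ℕ) (α : ℝ) (x y : EuclideanSpace ℝ (Fin n)) : ℝ :=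
  α ^ (((n : ℝ) - 2 * (k : ℝ)) / 2) * greenOne n k (Real.sqrt α • x) (Real.sqrt α • y)

/-! ### Bessel-type integrals: decay, scaling, smoothness, relation to `besselK`. -/

section

open MeasureTheory Set Filter Topology

/-! The source of everything is the subordination formula `(Δ+α)^{-k} = ∫_0^∞ t^{k-1}/(k-1)! e^{-αt}
e^{-tΔ} dt`. Its kernel, `greenRadial n (k-1) α r`, is a superposition of heat kernels and, up to a
constant, equals `besselIntegral a α (r²/4)` with `a = k-1-n/2`.

For `k = 1`, `α = 1` the substitution `t = (r/2)e^u` turns it into the Bessel kernel. The heat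
semigroup law reproduces the iterated convolutions (`integral_greenRadial_mul`), and scaling in `t`
gives `G_α^{(k)}` (`greenAlpha_eq_greenRadial`); radiality is then immediate. Dropping `e^{-αt}`
leaves a Gamma integral, hence a bound free of `α`; a quadratic lower bound for `cosh` gives the
exponential decay. Differentiating in `s` only lowers `a`, and every such integral decays faster
than any power of `s`, which gives membership in `𝔥_k`.

On the Fourier side the `t`-integral is the inverse of the symbol `(α+4π²|ξ|²)^k`, so the kernel is
a fundamental solution (`integral_greenRadial_schwartzOp`). For uniqueness, the difference `D` of
two solutions is integrable in `y`. Cutoffs allow testing it against cosines and sines,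
eigenfunctions with nonzero eigenvalue; so `D` has zero Fourier transform and vanishes where it is
continuous (`eq_zero_of_integral_mul_polyOp_eq_zero`). -/

/-- The integral `∫_0^∞ t^a e^{-αt - s/t} dt`. -/
noncomputable def besselIntegral (a α s : ℝ) : ℝ :=
  ∫ t in Ioi (0 : ℝ), t ^ a * Real.exp (-(α * t) - s / t)

/-- One term of the series of `e^{s/t}` suffices. The gained factor `t^m` cures the singularity of
`t^a` at `0`, and `s^{-m}` is the decay in `s`. -/
theorem exp_neg_div_le (m : ℕ) {s t : ℝ} (hs : 0 < s) (ht : 0 < t) :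
    Real.exp (-(s / t)) ≤ (m.factorial : ℝ) * t ^ m / s ^ m := by
  have h := Real.pow_div_factorial_le_exp (s / t) (by positivity) m
  rw [Real.exp_neg, inv_le_comm₀ (by positivity) (by positivity)]
  refine le_trans (le_of_eq ?_) h
  rw [div_pow]; field_simp

theorem besselIntegrand_le (m : ℕ) (a α : ℝ) {s t : ℝ} (hs : 0 < s) (ht : 0 < t) :
    t ^ a * Real.exp (-(α * t) - s / t) ≤
      (m.factorial : ℝ) / s ^ m * (t ^ (a + m) * Real.exp (-α * t)) := by
  rw [sub_eq_add_neg, Real.exp_add, Real.rpow_add ht, Real.rpow_natCast]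
  calc t ^ a * (Real.exp (-(α * t)) * Real.exp (-(s / t)))
      ≤ t ^ a * (Real.exp (-(α * t)) * ((m.factorial : ℝ) * t ^ m / s ^ m)) := by
        gcongr; exact exp_neg_div_le m hs ht
    _ = _ := by rw [neg_mul]; ring

theorem besselIntegrand_measurable (a α s : ℝ) :
    Measurable fun t : ℝ => t ^ a * Real.exp (-(α * t) - s / t) := by fun_prop

theorem integrableOn_rpow_mul_exp_neg_mul {a α : ℝ} (ha : -1 < a) (hα : 0 < α) :
    IntegrableOn (fun t : ℝ => t ^ a * Real.exp (-α * t)) (Ioi 0) := by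
  simpa using integrableOn_rpow_mul_exp_neg_mul_rpow (p := 1) ha one_pos hα

theorem exists_nat_neg_one_lt_add (a : ℝ) : ∃ m : ℕ, ∀ M : ℕ, m ≤ M → -1 < a + M := by
  obtain ⟨m, hm⟩ := exists_nat_gt (-1 - a)
  refine ⟨m, fun M hM => ?_⟩
  have : (m : ℝ) ≤ M := by exact_mod_cast hM
  linarith

theorem besselIntegrand_integrable (a : ℝ) {α s : ℝ} (hα : 0 < α) (hs : 0 < s) :
    IntegrableOn (fun t : ℝ => t ^ a * Real.exp (-(α * t) - s / t)) (Ioi 0) := by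
  obtain ⟨m, hm⟩ := exists_nat_neg_one_lt_add a
  refine Integrable.mono' ((integrableOn_rpow_mul_exp_neg_mul (hm m le_rfl) hα).const_mul
    ((m.factorial : ℝ) / s ^ m)) (besselIntegrand_measurable a α s).aestronglyMeasurable ?_
  filter_upwards [ae_restrict_mem measurableSet_Ioi] with t (ht : 0 < t)
  rw [Real.norm_of_nonneg (by positivity)]
  exact besselIntegrand_le m a α hs ht

theorem besselIntegral_nonneg (a α s : ℝ) : 0 ≤ besselIntegral a α s :=
  setIntegral_nonneg measurableSet_Ioi fun t (ht : 0 < t) => by positivity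

/-- Decay faster than any power. -/
theorem exists_besselIntegral_le (a : ℝ) {α : ℝ} (hα : 0 < α) :
    ∃ m : ℕ, ∀ M : ℕ, m ≤ M → ∃ C : ℝ, 0 ≤ C ∧ ∀ s : ℝ, 0 < s →
      besselIntegral a α s ≤ C / s ^ M := by
  obtain ⟨m, hm⟩ := exists_nat_neg_one_lt_add a
  refine ⟨m, fun M hM => ?_⟩
  refine ⟨(M.factorial : ℝ) * ∫ t in Ioi (0 : ℝ), t ^ (a + M) * Real.exp (-α * t),
    mul_nonneg (by positivity) (setIntegral_nonneg measurableSet_Ioi fun t (ht : 0 < t) => by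
      positivity), fun s hs => ?_⟩
  have := setIntegral_mono_on (besselIntegrand_integrable a hα hs)
    ((integrableOn_rpow_mul_exp_neg_mul (hm M hM) hα).const_mul ((M.factorial : ℝ) / s ^ M))
    measurableSet_Ioi fun t ht => besselIntegrand_le M a α hs ht
  refine this.trans (le_of_eq ?_)
  rw [integral_const_mul]; ring

theorem besselIntegral_scaling (a : ℝ) {α : ℝ} (hα : 0 < α) (s : ℝ) :
    besselIntegral a 1 (α * s) = α ^ (a + 1) * besselIntegral a α s := by
  have h := integral_comp_mul_left_Ioi (fun t : ℝ => t ^ a * Real.exp (-(1 * t) - α * s / t)) 0 hα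
  rw [mul_zero, smul_eq_mul, inv_mul_eq_div, eq_div_iff hα.ne'] at h
  rw [besselIntegral, ← h, besselIntegral, ← integral_mul_const, ← integral_const_mul]
  refine setIntegral_congr_fun measurableSet_Ioi fun t (ht : 0 < t) => ?_
  rw [Real.mul_rpow hα.le ht.le, Real.rpow_add_one hα.ne', mul_div_mul_left _ _ hα.ne', one_mul]
  ring

/-- The inversion `t ↦ 1/t` turns this into a Gamma integral. -/
theorem integral_rpow_mul_exp_neg_div {a s : ℝ} (ha : a < -1) (hs : 0 < s) :
    IntegrableOn (fun t : ℝ => t ^ a * Real.exp (-(s / t))) (Ioi 0) ∧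
    ∫ t in Ioi (0 : ℝ), t ^ a * Real.exp (-(s / t)) = s ^ (a + 1) * Real.Gamma (-a - 1) := by
  have key : ∀ x ∈ Ioi (0 : ℝ), (|(-1 : ℝ)| * x ^ ((-1 : ℝ) - 1)) •
      ((x ^ (-1 : ℝ)) ^ (-a - 1 - 1) * Real.exp (-(s * x ^ (-1 : ℝ)))) =
      x ^ a * Real.exp (-(s / x)) := by
    intro x (hx : 0 < x)
    rw [← Real.rpow_mul hx.le, smul_eq_mul, abs_neg, abs_one, one_mul, ← mul_assoc,
      ← Real.rpow_add hx, Real.rpow_neg_one, div_eq_mul_inv]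
    congr 2; ring
  constructor
  · have h := (integrableOn_Ioi_comp_rpow_iff
      (fun y : ℝ => y ^ (-a - 1 - 1) * Real.exp (-(s * y))) (p := -1) (by norm_num)).2 (by
        simpa using integrableOn_rpow_mul_exp_neg_mul (a := -a - 1 - 1) (by linarith) hs)
    exact (integrableOn_congr_fun key measurableSet_Ioi).1 h
  · have h := integral_comp_rpow_Ioi (fun y : ℝ => y ^ (-a - 1 - 1) * Real.exp (-(s * y)))
      (p := -1) (by norm_num)
    rw [setIntegral_congr_fun measurableSet_Ioi key,
      Real.integral_rpow_mul_exp_neg_mul_Ioi (by linarith) hs] at h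
    rw [h, one_div, Real.inv_rpow hs.le, ← Real.rpow_neg hs.le]
    congr 2; ring

/-- Discarding `e^{-αt} ≤ 1` makes the bound uniform in `α`; convergence at infinity then rests on
`a < -1`. -/
theorem besselIntegral_le_rpow {a α s : ℝ} (ha : a < -1) (hα : 0 < α) (hs : 0 < s) :
    besselIntegral a α s ≤ s ^ (a + 1) * Real.Gamma (-a - 1) := by
  obtain ⟨h1, h2⟩ := integral_rpow_mul_exp_neg_div ha hs
  rw [← h2]
  refine setIntegral_mono_on (besselIntegrand_integrable a hα hs) h1 measurableSet_Ioi
    fun t (ht : 0 < t) => ?_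
  gcongr
  have : 0 < α * t := by positivity
  linarith

theorem hasDerivAt_besselIntegral (a : ℝ) {α s : ℝ} (hα : 0 < α) (hs : 0 < s) :
    HasDerivAt (besselIntegral a α) (-besselIntegral (a - 1) α s) s := by
  have h := hasDerivAt_integral_of_dominated_loc_of_deriv_le
    (μ := volume.restrict (Ioi (0 : ℝ))) (𝕜 := ℝ) (s := Ioi (s / 2)) (x₀ := s)
    (F := fun s t : ℝ => t ^ a * Real.exp (-(α * t) - s / t))
    -- The derivative decreases in absolute value as `s` grows, so on `(s/2, ∞)` its value at `s/2`
    -- dominates.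
    (F' := fun s t : ℝ => -(t ^ (a - 1) * Real.exp (-(α * t) - s / t)))
    (bound := fun t : ℝ => t ^ (a - 1) * Real.exp (-(α * t) - s / 2 / t))
    (Ioi_mem_nhds (by linarith))
    (Eventually.of_forall fun s => (besselIntegrand_measurable a α s).aestronglyMeasurable)
    (besselIntegrand_integrable a hα hs)
    (besselIntegrand_measurable (a - 1) α s).neg.aestronglyMeasurable
    (by
      filter_upwards [ae_restrict_mem measurableSet_Ioi] with t (ht : 0 < t) x (hx : s / 2 < x)
      rw [norm_neg, Real.norm_of_nonneg (by positivity)]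
      gcongr)
    (besselIntegrand_integrable (a - 1) hα (by positivity))
    (by
      filter_upwards [ae_restrict_mem measurableSet_Ioi] with t (ht : 0 < t) x _
      have h1 : HasDerivAt (fun x : ℝ => -(α * t) - x / t) (-(1 / t)) x :=
        ((hasDerivAt_id x).div_const t).const_sub _
      convert! h1.exp.const_mul (t ^ a) using 1
      rw [Real.rpow_sub_one ht.ne']; ring)
  have h2 := h.2
  rw [integral_neg] at h2
  exact h2

theorem iteratedDerivWithin_besselIntegral (i : ℕ) (a : ℝ) {α : ℝ} (hα : 0 < α) :
    EqOn (iteratedDerivWithin i (besselIntegral a α) (Ioi 0))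
      (fun s => (-1) ^ i * besselIntegral (a - i) α s) (Ioi 0) := by
  induction i with
  | zero => intro s _; simp
  | succ i ih =>
    intro s (hs : 0 < s)
    rw [iteratedDerivWithin_succ, derivWithin_congr ih (ih hs),
      derivWithin_of_isOpen isOpen_Ioi hs,
      ((hasDerivAt_besselIntegral (a - i) hα hs).const_mul _).deriv]
    push_cast
    rw [pow_succ, sub_sub]; ring

theorem contDiffOn_besselIntegral (n : ℕ) (a : ℝ) {α : ℝ} (hα : 0 < α) :
    ContDiffOn ℝ n (besselIntegral a α) (Ioi 0) := by
  refine contDiffOn_of_differentiableOn_deriv fun m _ => ?_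
  refine DifferentiableOn.congr (fun s hs => ?_) (iteratedDerivWithin_besselIntegral m a hα)
  exact ((hasDerivAt_besselIntegral (a - m) hα hs).const_mul _).differentiableAt.differentiableWithinAt

theorem one_add_sq_div_two_le_cosh (u : ℝ) : 1 + u ^ 2 / 2 ≤ Real.cosh u := by
  have h1 : Real.cosh u = 1 + 2 * Real.sinh (u / 2) ^ 2 := by
    have h := Real.cosh_two_mul (u / 2)
    rw [mul_div_cancel₀ u two_ne_zero, Real.cosh_sq] at h
    rw [h]; ring
  have h2 : (u / 2) ^ 2 ≤ Real.sinh (u / 2) ^ 2 := by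
    rcases le_total 0 (u / 2) with h | h
    · exact pow_le_pow_left₀ h (Real.self_le_sinh_iff.2 h) 2
    · have := Real.sinh_le_self_iff.2 h
      nlinarith
  rw [h1]; linarith

theorem besselIntegrand_exp_substitution (a : ℝ) {r : ℝ} (hr : 0 < r) (u : ℝ) :
    |r / 2 * Real.exp u| • ((r / 2 * Real.exp u) ^ a *
      Real.exp (-(1 * (r / 2 * Real.exp u)) - r ^ 2 / 4 / (r / 2 * Real.exp u))) =
    (r / 2) ^ (a + 1) * Real.exp ((a + 1) * u - r * Real.cosh u) := by
  have h1 : -(1 * (r / 2 * Real.exp u)) - r ^ 2 / 4 / (r / 2 * Real.exp u)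
      = - (r * Real.cosh u) := by
    have := Real.exp_pos u
    rw [Real.cosh_eq, Real.exp_neg]; field_simp; ring
  rw [h1, abs_of_pos (by positivity), smul_eq_mul, Real.mul_rpow (by positivity) (by positivity),
    ← Real.exp_mul, Real.rpow_add_one (by positivity), sub_eq_add_neg, add_mul, one_mul, add_assoc,
    Real.exp_add, Real.exp_add, mul_comm a u]
  ring

theorem image_mul_exp_univ {c : ℝ} (hc : 0 < c) : (fun u => c * Real.exp u) '' univ = Ioi 0 := by
  ext t
  simp only [image_univ, mem_range, mem_Ioi]
  constructor
  · rintro ⟨u, rfl⟩; positivity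
  · intro ht
    exact ⟨Real.log (t / c), by rw [Real.exp_log (by positivity)]; field_simp⟩

theorem besselIntegral_one_eq_integral_cosh (a : ℝ) {r : ℝ} (hr : 0 < r) :
    Integrable (fun u : ℝ => Real.exp ((a + 1) * u - r * Real.cosh u)) ∧
    besselIntegral a 1 (r ^ 2 / 4) =
      (r / 2) ^ (a + 1) * ∫ u : ℝ, Real.exp ((a + 1) * u - r * Real.cosh u) := by
  have hd : ∀ u ∈ (univ : Set ℝ), HasDerivWithinAt (fun u => r / 2 * Real.exp u)
      (r / 2 * Real.exp u) univ u :=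
    fun u _ => ((Real.hasDerivAt_exp u).const_mul _).hasDerivWithinAt
  have hi : InjOn (fun u => r / 2 * Real.exp u) univ := fun x _ y _ h =>
    Real.exp_injective (mul_left_cancel₀ (by positivity) h)
  constructor
  · have h := (integrableOn_image_iff_integrableOn_abs_deriv_smul MeasurableSet.univ hd hi
      (fun t : ℝ => t ^ a * Real.exp (-(1 * t) - r ^ 2 / 4 / t))).1 (by
        rw [image_mul_exp_univ (by positivity)]
        exact besselIntegrand_integrable a one_pos (by positivity))
    rw [integrableOn_univ] at h
    simp_rw [besselIntegrand_exp_substitution a hr] at h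
    exact (integrable_const_mul_iff (by
      rw [isUnit_iff_ne_zero]; positivity) _).1 h
  · have h := integral_image_eq_integral_abs_deriv_smul MeasurableSet.univ hd hi
      (fun t : ℝ => t ^ a * Real.exp (-(1 * t) - r ^ 2 / 4 / t))
    rw [image_mul_exp_univ (by positivity), setIntegral_univ] at h
    simp_rw [besselIntegrand_exp_substitution a hr] at h
    rw [besselIntegral, h, integral_const_mul]

/-- The sharp exponential decay of the Bessel integral. -/
theorem exists_besselIntegral_one_le_exp (a : ℝ) : ∃ C : ℝ, 0 < C ∧ ∀ r : ℝ, 1 ≤ r →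
    besselIntegral a 1 (r ^ 2 / 4) ≤ C * r ^ (a + 1 / 2) * Real.exp (-r) := by
  refine ⟨(1 / 2) ^ (a + 1) * (Real.exp ((a + 1) ^ 2) * √(4 * Real.pi)), by positivity,
    fun r hr => ?_⟩
  have hr0 : 0 < r := by linarith
  obtain ⟨h1, h2⟩ := besselIntegral_one_eq_integral_cosh a hr0
  -- Combine `cosh u ≥ 1 + u²/2` with `(a+1)u ≤ (a+1)² + u²/4`; since `r ≥ 1`, half of `r u²/2`
  -- absorbs `u²/4`, leaving a Gaussian of total mass `√(4π/r)`.
  have h3 : ∫ u : ℝ, Real.exp ((a + 1) * u - r * Real.cosh u) ≤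
      ∫ u : ℝ, Real.exp ((a + 1) ^ 2) * Real.exp (-r) * Real.exp (-(r / 4) * u ^ 2) := by
    refine integral_mono h1 ((integrable_exp_neg_mul_sq (by positivity)).const_mul _) fun u => ?_
    simp only
    rw [← Real.exp_add, ← Real.exp_add]
    apply Real.exp_le_exp.2
    have hc := mul_le_mul_of_nonneg_left (one_add_sq_div_two_le_cosh u) hr0.le
    nlinarith [sq_nonneg ((a + 1) - u / 2), mul_nonneg (sub_nonneg.2 hr) (sq_nonneg u)]
  rw [integral_const_mul, integral_gaussian] at h3
  rw [h2]
  calc (r / 2) ^ (a + 1) * ∫ u : ℝ, Real.exp ((a + 1) * u - r * Real.cosh u)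
      ≤ (r / 2) ^ (a + 1) *
        (Real.exp ((a + 1) ^ 2) * Real.exp (-r) * √(Real.pi / (r / 4))) := by gcongr
    _ = _ := by
      have e1 : √(Real.pi / (r / 4)) = √(4 * Real.pi) * r ^ (-(1 / 2) : ℝ) := by
        rw [Real.rpow_neg hr0.le, ← Real.sqrt_eq_rpow, ← Real.sqrt_inv, ← Real.sqrt_mul (by positivity)]
        congr 1; field_simp
      have e2 : r ^ (a + 1 / 2) = r ^ (a + 1) * r ^ (-(1 / 2) : ℝ) := by
        rw [← Real.rpow_add hr0]; congr 1; ring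
      rw [e1, e2, div_eq_mul_one_div r 2, Real.mul_rpow hr0.le (by norm_num)]
      ring

/-- Folding the integral over `u ∈ ℝ` onto the half-line pairs `e^{-νu}` with `e^{νu}`, which
produces `2 cosh(νu)`. -/
theorem besselIntegral_eq_besselK (ν : ℝ) {r : ℝ} (hr : 0 < r) :
    besselIntegral (-ν - 1) 1 (r ^ 2 / 4) = 2 * (r / 2) ^ (-ν) * besselK ν r := by
  obtain ⟨h1, h2⟩ := besselIntegral_one_eq_integral_cosh (-ν - 1) hr
  rw [sub_add_cancel] at h1 h2
  rw [h2, ← intervalIntegral.integral_Iic_add_Ioi h1.integrableOn h1.integrableOn (b := 0),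
    ← neg_zero, ← integral_comp_neg_Ioi, neg_zero,
    ← integral_add (h1.comp_neg.integrableOn) h1.integrableOn, besselK, mul_comm 2, mul_assoc,
    ← integral_const_mul (2 : ℝ)]
  congr 1
  refine setIntegral_congr_fun measurableSet_Ioi fun t _ => ?_
  rw [Real.cosh_neg, Real.cosh_eq (ν * t), sub_eq_add_neg, sub_eq_add_neg, Real.exp_add,
    Real.exp_add, neg_mul_neg, neg_mul]
  ring

end

/-! ### Heat kernel, its superpositions `greenRadial`, iterated convolutions and pointwise bounds.
-/

section

open MeasureTheory Set Filter Topology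
open scoped ENNReal

/-- The heat kernel `(4πt)^{-n/2} e^{-r²/(4t)}` of `ℝⁿ` at distance `r`. -/
noncomputable def heatKernel (n : ℕ) (t r : ℝ) : ℝ :=
  (4 * Real.pi * t) ^ (-((n : ℝ) / 2)) * Real.exp (-(r ^ 2 / (4 * t)))

theorem heatKernel_nonneg (n : ℕ) {t : ℝ} (ht : 0 < t) (r : ℝ) : 0 ≤ heatKernel n t r := by
  unfold heatKernel; positivity

@[fun_prop]
theorem Measurable.heatKernel {X : Type*} [MeasurableSpace X] (n : ℕ) {f g : X → ℝ}
    (hf : Measurable f) (hg : Measurable g) : Measurable fun x => heatKernel n (f x) (g x) := by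
  unfold _root_.heatKernel; fun_prop

/-- The product of two heat kernels is a Gaussian in `z` about a weighted mean of `x` and `y`, times
the exponential of the heat kernel at time `t + s`. -/
theorem complete_square {E : Type*} [NormedAddCommGroup E] [InnerProductSpace ℝ E] (x y z : E)
    {t s : ℝ} (ht : 0 < t) (hs : 0 < s) :
    ‖x - z‖ ^ 2 / (4 * t) + ‖z - y‖ ^ 2 / (4 * s) =
      (t + s) / (4 * t * s) * ‖z - (t + s)⁻¹ • (s • x + t • y)‖ ^ 2 +
        ‖x - y‖ ^ 2 / (4 * (t + s)) := by
  set w := z - (t + s)⁻¹ • (s • x + t • y) with hw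
  have hts : t + s ≠ 0 := by positivity
  have h1 : x - z = (t / (t + s)) • (x - y) - w := by
    rw [hw]
    have : x = (t + s)⁻¹ • ((t + s) • x) := by rw [smul_smul, inv_mul_cancel₀ hts, one_smul]
    nth_rewrite 1 [this]
    module
  have h2 : z - y = (s / (t + s)) • (x - y) + w := by
    rw [hw]
    have : y = (t + s)⁻¹ • ((t + s) • y) := by rw [smul_smul, inv_mul_cancel₀ hts, one_smul]
    nth_rewrite 1 [this]
    module
  rw [h1, h2, norm_sub_sq_real, norm_add_sq_real, norm_smul, norm_smul, inner_smul_left,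
    inner_smul_left, Real.norm_of_nonneg (by positivity), Real.norm_of_nonneg (by positivity)]
  simp only [conj_trivial]
  field_simp
  ring

theorem integral_exp_neg_mul_norm_sub_sq {n : ℕ} {b : ℝ} (hb : 0 < b)
    (c : EuclideanSpace ℝ (Fin n)) :
    Integrable (fun z : EuclideanSpace ℝ (Fin n) => Real.exp (-b * ‖z - c‖ ^ 2)) ∧
    ∫ z : EuclideanSpace ℝ (Fin n), Real.exp (-b * ‖z - c‖ ^ 2) =
      (Real.pi / b) ^ ((n : ℝ) / 2) := by
  have h := GaussianFourier.integral_rexp_neg_mul_sq_norm (V := EuclideanSpace ℝ (Fin n)) hb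
  rw [finrank_euclideanSpace_fin] at h
  constructor
  · refine Integrable.comp_sub_right (f := fun z => Real.exp (-b * ‖z‖ ^ 2)) ?_ c
    -- The Bochner integral of a non-integrable function is `0`, so a nonzero value proves
    -- integrability.
    refine Integrable.of_integral_ne_zero ?_
    rw [h]; positivity
  · rw [integral_sub_right_eq_self (fun z => Real.exp (-b * ‖z‖ ^ 2)) c, h]

theorem integral_heatKernel {n : ℕ} (x : EuclideanSpace ℝ (Fin n)) {t : ℝ} (ht : 0 < t) :
    Integrable (fun z : EuclideanSpace ℝ (Fin n) => heatKernel n t ‖x - z‖) ∧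
    ∫ z : EuclideanSpace ℝ (Fin n), heatKernel n t ‖x - z‖ = 1 := by
  obtain ⟨h1, h2⟩ := integral_exp_neg_mul_norm_sub_sq (b := 1 / (4 * t)) (by positivity) x
  have e : ∀ z : EuclideanSpace ℝ (Fin n), heatKernel n t ‖x - z‖ =
      (4 * Real.pi * t) ^ (-((n : ℝ) / 2)) * Real.exp (-(1 / (4 * t)) * ‖z - x‖ ^ 2) := by
    intro z
    rw [heatKernel, norm_sub_rev]; congr 2; ring
  simp_rw [e]
  refine ⟨h1.const_mul _, ?_⟩
  rw [integral_const_mul, h2, show Real.pi / (1 / (4 * t)) = 4 * Real.pi * t by field_simp,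
    ← Real.rpow_add (by positivity)]
  simp

/-- The semigroup property of the heat kernel. -/
theorem lintegral_heatKernel_mul {n : ℕ} (x y : EuclideanSpace ℝ (Fin n)) {t s : ℝ} (ht : 0 < t)
    (hs : 0 < s) :
    ∫⁻ z : EuclideanSpace ℝ (Fin n), ENNReal.ofReal (heatKernel n t ‖x - z‖) *
      ENNReal.ofReal (heatKernel n s ‖z - y‖) =
      ENNReal.ofReal (heatKernel n (t + s) ‖x - y‖) := by
  obtain ⟨h1, h2⟩ := integral_exp_neg_mul_norm_sub_sq (b := (t + s) / (4 * t * s)) (by positivity)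
    ((t + s)⁻¹ • (s • x + t • y))
  have e : ∀ z : EuclideanSpace ℝ (Fin n), ENNReal.ofReal (heatKernel n t ‖x - z‖) *
      ENNReal.ofReal (heatKernel n s ‖z - y‖) =
      ENNReal.ofReal ((4 * Real.pi * t) ^ (-((n : ℝ) / 2)) * (4 * Real.pi * s) ^ (-((n : ℝ) / 2)) *
        Real.exp (-(‖x - y‖ ^ 2 / (4 * (t + s)))) *
        Real.exp (-((t + s) / (4 * t * s)) * ‖z - (t + s)⁻¹ • (s • x + t • y)‖ ^ 2)) := by
    intro z
    rw [← ENNReal.ofReal_mul (heatKernel_nonneg n ht _), heatKernel, heatKernel]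
    have := complete_square x y z ht hs
    rw [mul_assoc (_ * _) (Real.exp _) (Real.exp _), ← Real.exp_add, mul_mul_mul_comm,
      ← Real.exp_add]
    congr 3
    linarith
  simp_rw [e]
  rw [← ofReal_integral_eq_lintegral_ofReal (h1.const_mul _)
    (Eventually.of_forall fun z => by positivity), integral_const_mul, h2, heatKernel,
    mul_right_comm, ← Real.mul_rpow (by positivity) (by positivity), Real.rpow_neg (by positivity),
    Real.rpow_neg (by positivity), ← Real.inv_rpow (by positivity), ← Real.inv_rpow (by positivity),
    ← Real.mul_rpow (by positivity) (by positivity)]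
  congr 3
  field_simp

/-- The kernel of `(Δ + α)^{-(j+1)}` at distance `r`. -/
noncomputable def greenRadial (n j : ℕ) (α r : ℝ) : ℝ :=
  ∫ t in Ioi (0 : ℝ), t ^ j / j.factorial * Real.exp (-(α * t)) * heatKernel n t r

theorem greenRadial_integrand_eq (n j : ℕ) (α r : ℝ) {t : ℝ} (ht : 0 < t) :
    t ^ j / j.factorial * Real.exp (-(α * t)) * heatKernel n t r =
      (4 * Real.pi) ^ (-((n : ℝ) / 2)) / j.factorial *
        (t ^ ((j : ℝ) - n / 2) * Real.exp (-(α * t) - r ^ 2 / 4 / t)) := by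
  rw [heatKernel, Real.mul_rpow (by positivity) ht.le, sub_eq_add_neg (j : ℝ), Real.rpow_add ht,
    Real.rpow_natCast, sub_eq_add_neg, Real.exp_add, div_div]
  ring

theorem greenRadial_eq (n j : ℕ) (α r : ℝ) :
    greenRadial n j α r = (4 * Real.pi) ^ (-((n : ℝ) / 2)) / j.factorial *
      besselIntegral ((j : ℝ) - n / 2) α (r ^ 2 / 4) := by
  rw [greenRadial, besselIntegral, ← integral_const_mul]
  exact setIntegral_congr_fun measurableSet_Ioi fun t ht => greenRadial_integrand_eq n j α r ht

theorem greenRadial_integrand_integrable (n j : ℕ) {α r : ℝ} (hα : 0 < α) (hr : 0 < r) :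
    IntegrableOn (fun t : ℝ => t ^ j / j.factorial * Real.exp (-(α * t)) * heatKernel n t r)
      (Ioi 0) :=
  (integrableOn_congr_fun (fun t ht => greenRadial_integrand_eq n j α r ht) measurableSet_Ioi).2
    ((besselIntegrand_integrable _ hα (by positivity)).const_mul _)

theorem greenRadial_nonneg (n j : ℕ) (α r : ℝ) : 0 ≤ greenRadial n j α r := by
  rw [greenRadial_eq]
  exact mul_nonneg (by positivity) (besselIntegral_nonneg _ _ _)

theorem ofReal_greenRadial (n j : ℕ) {α r : ℝ} (hα : 0 < α) (hr : 0 < r) :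
    ENNReal.ofReal (greenRadial n j α r) =
      ∫⁻ t in Ioi (0 : ℝ), ENNReal.ofReal (t ^ j / j.factorial * Real.exp (-(α * t))) *
        ENNReal.ofReal (heatKernel n t r) := by
  rw [greenRadial, ofReal_integral_eq_lintegral_ofReal (greenRadial_integrand_integrable n j hα hr)]
  · refine setLIntegral_congr_fun measurableSet_Ioi fun t (ht : 0 < t) => ?_
    rw [ENNReal.ofReal_mul (by positivity)]
  · filter_upwards [ae_restrict_mem measurableSet_Ioi] with t (ht : 0 < t)
    have := heatKernel_nonneg n ht r
    simp only [Pi.zero_apply]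
    positivity

@[fun_prop]
theorem measurable_greenRadial (n j : ℕ) (α : ℝ) : Measurable (greenRadial n j α) := by
  have : StronglyMeasurable (Function.uncurry fun r t : ℝ =>
      t ^ j / j.factorial * Real.exp (-(α * t)) * heatKernel n t r) := by
    apply Measurable.stronglyMeasurable
    unfold Function.uncurry
    fun_prop
  exact (this.integral_prod_right (ν := volume.restrict (Ioi (0 : ℝ)))).measurable

theorem lintegral_Ioo_pow_div_factorial (j : ℕ) {u : ℝ} (hu : 0 < u) :
    ∫⁻ t in Ioo (0 : ℝ) u, ENNReal.ofReal (t ^ j / j.factorial) =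
      ENNReal.ofReal (u ^ (j + 1) / (j + 1).factorial) := by
  rw [← ofReal_integral_eq_lintegral_ofReal]
  · rw [← integral_Ioc_eq_integral_Ioo, ← intervalIntegral.integral_of_le hu.le,
      intervalIntegral.integral_div, integral_pow, Nat.factorial_succ]
    congr 1
    push_cast
    have : (j.factorial : ℝ) ≠ 0 := by positivity
    field_simp
    simp
  · exact ((by fun_prop : Continuous fun t : ℝ => t ^ j / (j.factorial : ℝ)).integrableOn_Icc).mono_set
      Ioo_subset_Icc_self
  · filter_upwards [ae_restrict_mem measurableSet_Ioo] with t ht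
    have := ht.1
    simp only [Pi.zero_apply]
    positivity

theorem lintegral_Ioi_comp_add_left (f : ℝ → ℝ≥0∞) (t : ℝ) :
    ∫⁻ s in Ioi (0 : ℝ), f (t + s) = ∫⁻ u in Ioi t, f u := by
  rw [← lintegral_indicator measurableSet_Ioi, ← lintegral_indicator measurableSet_Ioi,
    ← lintegral_add_left_eq_self ((Ioi t).indicator f) t]
  congr 1 with s
  simp [indicator]

theorem lintegral_Ioi_Ioi_swap {f : ℝ → ℝ → ℝ≥0∞} (hf : Measurable (Function.uncurry f)) :
    ∫⁻ t in Ioi (0 : ℝ), ∫⁻ u in Ioi t, f t u = ∫⁻ u in Ioi (0 : ℝ), ∫⁻ t in Ioo (0 : ℝ) u, f t u := by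
  have hm : Measurable (Function.uncurry fun t u : ℝ =>
      {p : ℝ × ℝ | 0 < p.1 ∧ p.1 < p.2}.indicator (Function.uncurry f) (t, u)) := by
    refine hf.indicator ?_
    exact (measurableSet_lt measurable_const measurable_fst).inter
      (measurableSet_lt measurable_fst measurable_snd)
  have h := lintegral_lintegral_swap (μ := (volume : Measure ℝ)) (ν := (volume : Measure ℝ))
    hm.aemeasurable
  rw [← lintegral_indicator measurableSet_Ioi, ← lintegral_indicator measurableSet_Ioi]
  convert h using 2 with t u
  · ext t
    by_cases ht : 0 < t
    · rw [indicator_of_mem (show t ∈ Ioi 0 from ht), ← lintegral_indicator measurableSet_Ioi]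
      congr 1 with u
      simp [indicator, ht]
    · rw [indicator_of_notMem (show t ∉ Ioi 0 from ht)]
      simp [indicator, ht]
  · ext u
    by_cases hu : 0 < u
    · rw [indicator_of_mem (show u ∈ Ioi 0 from hu), ← lintegral_indicator measurableSet_Ioo]
      congr 1 with t
    · rw [indicator_of_notMem (show u ∉ Ioi 0 from hu)]
      have : ∀ t : ℝ, ¬ (0 < t ∧ t < u) := fun t h => hu (h.1.trans h.2)
      simp [indicator, this]

/-- By Tonelli and the semigroup law, the spatial convolution becomes a convolution of the time
weights. With `u = t + s` the exponentials merge to `e^{-αu}`, and `∫_0^u t^j/j! dt` raises the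
index by one. Working in `ℝ≥0∞` postpones all integrability questions. -/
theorem lintegral_greenRadial_mul {n : ℕ} (j : ℕ) {α : ℝ} (hα : 0 < α)
    {x y : EuclideanSpace ℝ (Fin n)} (hxy : x ≠ y) :
    ∫⁻ z : EuclideanSpace ℝ (Fin n), ENNReal.ofReal (greenRadial n j α ‖x - z‖) *
      ENNReal.ofReal (greenRadial n 0 α ‖z - y‖) =
      ENNReal.ofReal (greenRadial n (j + 1) α ‖x - y‖) := by
  have : Nontrivial (EuclideanSpace ℝ (Fin n)) := ⟨x, y, hxy⟩
  have hpos : ∀ {a b : EuclideanSpace ℝ (Fin n)}, a ≠ b → 0 < ‖a - b‖ := fun h =>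
    norm_pos_iff.2 (sub_ne_zero.2 h)
  set A : ℝ → ℝ≥0∞ := fun t => ENNReal.ofReal (t ^ j / j.factorial * Real.exp (-(α * t))) with hA
  set B : ℝ → ℝ≥0∞ := fun t => ENNReal.ofReal (t ^ 0 / (0 : ℕ).factorial * Real.exp (-(α * t)))
    with hB
  have hAm : Measurable A := by fun_prop
  have hBm : Measurable B := by fun_prop
  calc
    _ = ∫⁻ z : EuclideanSpace ℝ (Fin n),
          ∫⁻ t in Ioi (0 : ℝ), ∫⁻ s in Ioi (0 : ℝ),
            (A t * ENNReal.ofReal (heatKernel n t ‖x - z‖)) *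
              (B s * ENNReal.ofReal (heatKernel n s ‖z - y‖)) := by
        refine lintegral_congr_ae ?_
        filter_upwards [Measure.ae_ne volume x, Measure.ae_ne volume y] with z hzx hzy
        rw [ofReal_greenRadial n j hα (hpos hzx.symm), ofReal_greenRadial n 0 hα (hpos hzy),
          ← lintegral_mul_const _ (by fun_prop)]
        refine lintegral_congr fun t => ?_
        rw [← lintegral_const_mul _ (by fun_prop)]
    _ = ∫⁻ t in Ioi (0 : ℝ), ∫⁻ z : EuclideanSpace ℝ (Fin n), ∫⁻ s in Ioi (0 : ℝ),
            (A t * ENNReal.ofReal (heatKernel n t ‖x - z‖)) *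
              (B s * ENNReal.ofReal (heatKernel n s ‖z - y‖)) := by
        refine lintegral_lintegral_swap (Measurable.aemeasurable ?_)
        exact Measurable.lintegral_prod_right' (f := fun p : (EuclideanSpace ℝ (Fin n) × ℝ) × ℝ =>
          (A p.1.2 * ENNReal.ofReal (heatKernel n p.1.2 ‖x - p.1.1‖)) *
              (B p.2 * ENNReal.ofReal (heatKernel n p.2 ‖p.1.1 - y‖))) (by fun_prop)
    _ = ∫⁻ t in Ioi (0 : ℝ), ∫⁻ s in Ioi (0 : ℝ),
            A t * (B s * ENNReal.ofReal (heatKernel n (t + s) ‖x - y‖)) := by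
        refine setLIntegral_congr_fun measurableSet_Ioi fun t ht => ?_
        rw [lintegral_lintegral_swap (Measurable.aemeasurable (by
          unfold Function.uncurry; fun_prop))]
        refine setLIntegral_congr_fun measurableSet_Ioi fun s hs => ?_
        rw [← lintegral_heatKernel_mul x y ht hs, ← lintegral_const_mul _ (by fun_prop),
          ← lintegral_const_mul _ (by fun_prop)]
        refine lintegral_congr fun z => ?_
        ring
    _ = ∫⁻ t in Ioi (0 : ℝ), ∫⁻ u in Ioi t,
            A t * (B (u - t) * ENNReal.ofReal (heatKernel n u ‖x - y‖)) := by
        refine lintegral_congr fun t => ?_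
        rw [← lintegral_Ioi_comp_add_left
          (fun u => A t * (B (u - t) * ENNReal.ofReal (heatKernel n u ‖x - y‖))) t]
        simp only [add_sub_cancel_left]
    _ = ∫⁻ u in Ioi (0 : ℝ), ∫⁻ t in Ioo (0 : ℝ) u,
            A t * (B (u - t) * ENNReal.ofReal (heatKernel n u ‖x - y‖)) := by
        refine lintegral_Ioi_Ioi_swap ?_
        unfold Function.uncurry; fun_prop
    _ = ∫⁻ u in Ioi (0 : ℝ), ENNReal.ofReal (u ^ (j + 1) / (j + 1).factorial *
          Real.exp (-(α * u))) * ENNReal.ofReal (heatKernel n u ‖x - y‖) := by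
        refine setLIntegral_congr_fun measurableSet_Ioi fun u (hu : 0 < u) => ?_
        rw [ENNReal.ofReal_mul (by positivity), ← lintegral_Ioo_pow_div_factorial j hu,
          ← lintegral_mul_const _ (by fun_prop), ← lintegral_mul_const _ (by fun_prop)]
        refine setLIntegral_congr_fun measurableSet_Ioo fun t ht => ?_
        have ht0 := ht.1
        simp only [hA, hB]
        have e : Real.exp (-(α * u)) = Real.exp (-(α * t)) * Real.exp (-(α * (u - t))) := by
          rw [← Real.exp_add]; congr 1; ring
        rw [e, ENNReal.ofReal_mul (p := t ^ j / _) (by positivity),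
          ENNReal.ofReal_mul (p := Real.exp _) (by positivity), pow_zero, Nat.factorial_zero,
          Nat.cast_one, div_one, one_mul]
        ring
    _ = _ := (ofReal_greenRadial n (j + 1) hα (hpos hxy)).symm

theorem integral_greenRadial_mul {n : ℕ} (j : ℕ) {α : ℝ} (hα : 0 < α)
    {x y : EuclideanSpace ℝ (Fin n)} (hxy : x ≠ y) :
    Integrable (fun z : EuclideanSpace ℝ (Fin n) =>
      greenRadial n j α ‖x - z‖ * greenRadial n 0 α ‖z - y‖) ∧
    ∫ z : EuclideanSpace ℝ (Fin n), greenRadial n j α ‖x - z‖ * greenRadial n 0 α ‖z - y‖ =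
      greenRadial n (j + 1) α ‖x - y‖ := by
  have h := lintegral_greenRadial_mul j hα hxy
  simp_rw [← ENNReal.ofReal_mul (greenRadial_nonneg n j α _)] at h
  have h0 : ∀ z : EuclideanSpace ℝ (Fin n),
      0 ≤ greenRadial n j α ‖x - z‖ * greenRadial n 0 α ‖z - y‖ := fun z =>
    mul_nonneg (greenRadial_nonneg _ _ _ _) (greenRadial_nonneg _ _ _ _)
  have hm : AEStronglyMeasurable (fun z : EuclideanSpace ℝ (Fin n) =>
      greenRadial n j α ‖x - z‖ * greenRadial n 0 α ‖z - y‖) volume :=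
    Measurable.aestronglyMeasurable (by fun_prop)
  constructor
  · refine ⟨hm, ?_⟩
    rw [hasFiniteIntegral_iff_ofReal (Eventually.of_forall h0), h]
    exact ENNReal.ofReal_lt_top
  · rw [integral_eq_lintegral_of_nonneg_ae (Eventually.of_forall h0) hm, h,
      ENNReal.toReal_ofReal (greenRadial_nonneg _ _ _ _)]

theorem greenRadial_zero_eq_besselKernel {n : ℕ} {x y : EuclideanSpace ℝ (Fin n)} (hxy : x ≠ y) :
    greenRadial n 0 1 ‖x - y‖ = besselKernel n x y := by
  have hr : 0 < ‖x - y‖ := norm_pos_iff.2 (sub_ne_zero.2 hxy)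
  have h := besselIntegral_eq_besselK (((n : ℝ) - 2) / 2) hr
  rw [greenRadial_eq, besselKernel, Nat.cast_zero,
    show (0 : ℝ) - n / 2 = -(((n : ℝ) - 2) / 2) - 1 by ring, h, Nat.factorial_zero, Nat.cast_one,
    div_one, ← mul_assoc, ← mul_assoc]
  congr 1
  rw [div_eq_mul_inv ‖x - y‖ 2, Real.mul_rpow hr.le (by norm_num), Real.inv_rpow (by norm_num),
    ← Real.rpow_neg (by norm_num), neg_neg,
    show 4 * Real.pi = 2 * Real.pi * 2 by ring,
    Real.mul_rpow (by positivity) (by norm_num : (0 : ℝ) ≤ 2)]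
  have e : (2 : ℝ) ^ (-((n : ℝ) / 2)) * (2 * 2 ^ (((n : ℝ) - 2) / 2)) = 1 := by
    have e' : (2 : ℝ) * 2 ^ (((n : ℝ) - 2) / 2) = 2 ^ (1 + ((n : ℝ) - 2) / 2) := by
      rw [Real.rpow_add two_pos, Real.rpow_one]
    rw [e', ← Real.rpow_add two_pos, show -((n : ℝ) / 2) + (1 + (n - 2) / 2) = 0 by ring, Real.rpow_zero]
  linear_combination (2 * Real.pi) ^ (-((n : ℝ) / 2)) * ‖x - y‖ ^ (-(((n : ℝ) - 2) / 2)) * e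

/-- Index `j + 1` corresponds to the weight `t^j/j!`. The identification fails to be known only at
`z = x` and `z = y`, a null set for the convolution. -/
theorem greenOne_eq_greenRadial {n : ℕ} (j : ℕ) :
    ∀ {x y : EuclideanSpace ℝ (Fin n)}, x ≠ y →
      greenOne n (j + 1) x y = greenRadial n j 1 ‖x - y‖ := by
  induction j with
  | zero => intro x y hxy; exact (greenRadial_zero_eq_besselKernel hxy).symm
  | succ j ih =>
    intro x y hxy
    have : Nontrivial (EuclideanSpace ℝ (Fin n)) := ⟨x, y, hxy⟩
    rw [← (integral_greenRadial_mul j one_pos hxy).2, greenOne]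
    refine integral_congr_ae ?_
    filter_upwards [Measure.ae_ne volume x, Measure.ae_ne volume y] with z hzx hzy
    rw [ih hzx.symm, greenRadial_zero_eq_besselKernel hzy]

theorem integrable_greenOne_mul {n : ℕ} (j : ℕ) {x y : EuclideanSpace ℝ (Fin n)}
    (hxy : x ≠ y) : Integrable (fun z => greenOne n (j + 1) x z * greenOne n 1 z y) := by
  have : Nontrivial (EuclideanSpace ℝ (Fin n)) := ⟨x, y, hxy⟩
  refine (integral_greenRadial_mul j one_pos hxy).1.congr ?_
  filter_upwards [Measure.ae_ne volume x, Measure.ae_ne volume y] with z hzx hzy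
  rw [greenOne_eq_greenRadial j hzx.symm, greenOne_eq_greenRadial 0 hzy]

/-- Rescaling `t` by `α` produces exactly the inverse of the prefactor `α^{(n-2k)/2}`. -/
theorem greenAlpha_eq_greenRadial {n : ℕ} (j : ℕ) {α : ℝ} (hα : 0 < α)
    {x y : EuclideanSpace ℝ (Fin n)} (hxy : x ≠ y) :
    greenAlpha n (j + 1) α x y = greenRadial n j α ‖x - y‖ := by
  have hs : 0 < √α := Real.sqrt_pos.2 hα
  have hne : √α • x ≠ √α • y := fun h => hxy (smul_right_injective _ hs.ne' h)
  rw [greenAlpha, greenOne_eq_greenRadial j hne, ← smul_sub, norm_smul, Real.norm_of_nonneg hs.le,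
    greenRadial_eq, greenRadial_eq, mul_pow, Real.sq_sqrt hα.le, mul_div_assoc,
    besselIntegral_scaling _ hα, mul_left_comm, ← mul_assoc (α ^ _) (α ^ _), ← Real.rpow_add hα]
  push_cast
  rw [show ((n : ℝ) - 2 * (j + 1)) / 2 + (j - n / 2 + 1) = 0 by ring, Real.rpow_zero, one_mul]

theorem exists_greenRadial_le_rpow (n j : ℕ) (hn : 2 * (j + 1) < n) : ∃ C : ℝ, 0 < C ∧
    ∀ α r : ℝ, 0 < α → 0 < r → greenRadial n j α r ≤ C * r ^ (2 * ((j + 1 : ℕ) : ℝ) - n) := by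
  have hn' : 2 * ((j : ℝ) + 1) < n := by exact_mod_cast hn
  have hG : 0 < Real.Gamma (-((j : ℝ) - n / 2) - 1) := Real.Gamma_pos_of_pos (by linarith)
  refine ⟨(4 * Real.pi) ^ (-((n : ℝ) / 2)) / j.factorial * ((1 / 4) ^ ((j : ℝ) - n / 2 + 1) *
    Real.Gamma (-((j : ℝ) - n / 2) - 1)), by positivity, fun α r hα hr => ?_⟩
  rw [greenRadial_eq, mul_assoc]
  gcongr
  refine (besselIntegral_le_rpow (by linarith) hα (by positivity)).trans (le_of_eq ?_)
  rw [div_eq_mul_one_div (r ^ 2) 4, Real.mul_rpow (by positivity) (by norm_num), ← Real.rpow_natCast,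
    ← Real.rpow_mul hr.le]
  push_cast
  rw [show 2 * ((j : ℝ) - n / 2 + 1) = 2 * (j + 1) - n by ring]
  ring

theorem exists_greenRadial_le_exp (n j : ℕ) (hn : 1 ≤ n) : ∃ C : ℝ, 0 < C ∧
    ∀ α r : ℝ, 0 < α → 0 < r → 1 ≤ √α * r →
      greenRadial n j α r ≤ C * α ^ (((j + 1 : ℕ) : ℝ) * (((n : ℝ) - 3) / 4)) *
        r ^ (((((j + 1 : ℕ) : ℝ) - 2) * n + ((j + 1 : ℕ) : ℝ)) / 2) * Real.exp (-(√α * r)) := by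
  obtain ⟨C, hC, h⟩ := exists_besselIntegral_one_le_exp ((j : ℝ) - n / 2)
  refine ⟨(4 * Real.pi) ^ (-((n : ℝ) / 2)) / j.factorial * C, by positivity,
    fun α r hα hr hαr => ?_⟩
  have hs : 0 < √α := Real.sqrt_pos.2 hα
  have h1 := besselIntegral_scaling ((j : ℝ) - n / 2) hα (r ^ 2 / 4)
  have h2 := h (√α * r) hαr
  rw [mul_pow, Real.sq_sqrt hα.le, mul_div_assoc, h1] at h2
  set q : ℝ := ((((j + 1 : ℕ) : ℝ) - 2) * n + ((j + 1 : ℕ) : ℝ)) / 2 with hq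
  have hn1 : (1 : ℝ) ≤ n := by exact_mod_cast hn
  -- The natural exponent is smaller than the required `q` by `j(n-1)/2 ≥ 0`; enlarging it is
  -- harmless because `√α r ≥ 1`.
  have h3 : (√α * r) ^ ((j : ℝ) - n / 2 + 1 / 2) ≤ (√α * r) ^ q := by
    apply Real.rpow_le_rpow_of_exponent_le hαr
    have : (j : ℝ) * 1 ≤ j * n := by gcongr
    rw [hq]; push_cast; linarith
  have h4 : besselIntegral ((j : ℝ) - n / 2) α (r ^ 2 / 4) ≤
      α ^ (-((j : ℝ) - n / 2 + 1)) * (C * (√α * r) ^ q * Real.exp (-(√α * r))) := by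
    rw [Real.rpow_neg hα.le, ← div_eq_inv_mul, le_div_iff₀ (by positivity), mul_comm]
    exact h2.trans (by gcongr)
  rw [greenRadial_eq]
  calc _ ≤ (4 * Real.pi) ^ (-((n : ℝ) / 2)) / j.factorial *
        (α ^ (-((j : ℝ) - n / 2 + 1)) * (C * (√α * r) ^ q * Real.exp (-(√α * r)))) := by gcongr
    _ = _ := by
      have e : α ^ (((j + 1 : ℕ) : ℝ) * (((n : ℝ) - 3) / 4)) =
          α ^ (-((j : ℝ) - n / 2 + 1)) * α ^ (q / 2) := by
        rw [← Real.rpow_add hα, hq]; congr 1; push_cast; ring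
      rw [e, Real.mul_rpow hs.le hr.le, Real.sqrt_eq_rpow, ← Real.rpow_mul hα.le,
        one_div_mul_eq_div]
      ring

end

/-! ### Regularity and decay of derivatives: membership in `𝔥_k`. -/

section

open MeasureTheory Set Filter Topology
open scoped ENNReal

theorem hasFDerivAt_clm_sub_const {E F : Type*} [NormedAddCommGroup E] [NormedSpace ℝ E]
    [NormedAddCommGroup F] [NormedSpace ℝ F] (L : E →L[ℝ] F) (x y : E) :
    HasFDerivAt (fun y => L (y - x)) L y := by
  have h := L.hasFDerivAt.comp y ((hasFDerivAt_id y).sub_const x)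
  rwa [ContinuousLinearMap.comp_id] at h

/-- The function is quadratic, so only orders 1 and 2 contribute. The form `D ^ i` with `D = ‖x -
y‖` is what the Faà di Bruno estimate `norm_iteratedFDerivWithin_comp_le` takes as input. -/
theorem norm_iteratedFDeriv_norm_sub_sq_div_four_le {E : Type*} [NormedAddCommGroup E]
    [InnerProductSpace ℝ E] (x y : E) (hy : 1 ≤ ‖x - y‖) (i : ℕ) (hi : 1 ≤ i) :
    ‖iteratedFDeriv ℝ i (fun y : E => ‖x - y‖ ^ 2 / 4) y‖ ≤ ‖x - y‖ ^ i := by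
  have h1 : fderiv ℝ (fun y : E => ‖x - y‖ ^ 2 / 4) =
      fun y => (1 / 2 : ℝ) • innerSL ℝ (y - x) := by
    funext y
    have h : HasFDerivAt (fun y : E => ‖x - y‖ ^ 2)
        (2 • (innerSL ℝ (x - y)).comp (-ContinuousLinearMap.id ℝ E)) y :=
      ((hasFDerivAt_id y).const_sub x).norm_sq
    have h' := (h.mul_const (1 / 4 : ℝ)).fderiv
    simp only [mul_one_div] at h'
    rw [h']
    ext v
    simp
    ring
  have h2 : fderiv ℝ (fun y : E => (1 / 2 : ℝ) • innerSL ℝ (y - x)) =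
      fun _ => (1 / 2 : ℝ) • (innerSL ℝ : E →L[ℝ] E →L[ℝ] ℝ) := by
    funext y
    have h : HasFDerivAt (fun y : E => innerSL ℝ (y - x))
        (innerSL ℝ : E →L[ℝ] E →L[ℝ] ℝ) y :=
      hasFDerivAt_clm_sub_const (innerSL ℝ : E →L[ℝ] E →L[ℝ] ℝ) x y
    exact (h.const_smul (1 / 2 : ℝ)).fderiv
  match i, hi with
  | 1, _ =>
    rw [← norm_iteratedFDeriv_fderiv, norm_iteratedFDeriv_zero, h1, norm_smul, innerSL_apply_norm,
      norm_sub_rev y x, pow_one]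
    norm_num
    linarith
  | 2, _ =>
    rw [← norm_iteratedFDeriv_fderiv, h1, ← norm_iteratedFDeriv_fderiv, h2,
      norm_iteratedFDeriv_zero, norm_smul]
    have h3 := norm_innerSL_le (𝕜 := ℝ) (E := E)
    have h4 := one_le_pow₀ hy (n := 2)
    norm_num
    linarith
  | i + 3, _ =>
    rw [← norm_iteratedFDeriv_fderiv, h1, ← norm_iteratedFDeriv_fderiv, h2,
      iteratedFDeriv_const_of_ne (by simp)]
    simp only [Pi.zero_apply, norm_zero]
    positivity

/-- Each order `i` has its own threshold, that of the parameter `a - i`; the maximum over `i ≤ N`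
serves all orders with a common power `M`. -/
theorem exists_iteratedDerivWithin_besselIntegral_le (a : ℝ) {α : ℝ} (hα : 0 < α) (N : ℕ) :
    ∃ m : ℕ, ∀ M : ℕ, m ≤ M → ∃ C : ℝ, 0 ≤ C ∧ ∀ i ≤ N, ∀ s : ℝ, 0 < s →
      ‖iteratedFDerivWithin ℝ i (besselIntegral a α) (Ioi 0) s‖ ≤ C / s ^ M := by
  choose m hm using fun i : ℕ => exists_besselIntegral_le (a - i) hα
  refine ⟨(Finset.range (N + 1)).sup m, fun M hM => ?_⟩
  choose! C hC using fun (i : ℕ) (hi : m i ≤ M) => hm i M hi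
  have hiM : ∀ i ≤ N, m i ≤ M := fun i hi =>
    (Finset.le_sup (Finset.mem_range.2 (Nat.lt_succ_of_le hi))).trans hM
  refine ⟨∑ i ∈ Finset.range (N + 1), C i, Finset.sum_nonneg fun i hi =>
    (hC i (hiM i (Nat.le_of_lt_succ (Finset.mem_range.1 hi)))).1, fun i hi s hs => ?_⟩
  rw [norm_iteratedFDerivWithin_eq_norm_iteratedDerivWithin,
    iteratedDerivWithin_besselIntegral i a hα hs, norm_mul, norm_pow, norm_neg, norm_one, one_pow,
    one_mul, Real.norm_of_nonneg (besselIntegral_nonneg _ _ _)]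
  refine ((hC i (hiM i hi)).2 s hs).trans ?_
  gcongr
  exact Finset.single_le_sum (f := C) (fun i hi =>
    (hC i (hiM i (Nat.le_of_lt_succ (Finset.mem_range.1 hi)))).1)
    (Finset.mem_range.2 (Nat.lt_succ_of_le hi))

theorem greenAlpha_contDiffOn (n j N : ℕ) {α : ℝ} (hα : 0 < α) :
    ContDiffOn ℝ N (fun p : EuclideanSpace ℝ (Fin n) × EuclideanSpace ℝ (Fin n) =>
      greenAlpha n (j + 1) α p.1 p.2) {p | p.1 ≠ p.2} := by
  have h : ContDiffOn ℝ N (fun p : EuclideanSpace ℝ (Fin n) × EuclideanSpace ℝ (Fin n) =>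
      (4 * Real.pi) ^ (-((n : ℝ) / 2)) / j.factorial *
        besselIntegral ((j : ℝ) - n / 2) α (‖p.1 - p.2‖ ^ 2 / 4)) {p | p.1 ≠ p.2} := by
    refine contDiffOn_const.mul ?_
    refine (contDiffOn_besselIntegral N ((j : ℝ) - n / 2) hα).comp
      (((contDiff_fst.sub contDiff_snd).norm_sq ℝ).div_const 4).contDiffOn fun p hp => ?_
    have : 0 < ‖p.1 - p.2‖ := norm_pos_iff.2 (sub_ne_zero.2 hp)
    simp only [mem_Ioi]
    positivity
  refine h.congr fun p hp => ?_
  rw [greenAlpha_eq_greenRadial j hα hp, greenRadial_eq]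

theorem greenAlpha_derivatives_decay (n j N : ℕ) {α : ℝ} (hα : 0 < α) (p : ℝ) :
    ∃ C : ℝ, 0 < C ∧ ∀ l : ℕ, l ≤ N → ∀ x y : EuclideanSpace ℝ (Fin n), 1 ≤ ‖x - y‖ →
      ‖iteratedFDeriv ℝ l (greenAlpha n (j + 1) α x) y‖ ≤ C * ‖x - y‖ ^ (-p) := by
  obtain ⟨m, hm⟩ := exists_iteratedDerivWithin_besselIntegral_le ((j : ℝ) - n / 2) hα N
  -- The chain rule costs up to `r^N` and `r^{-p}` must remain, while `s^{-M}` with `s = r²/4`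
  -- supplies `r^{-2M}`; `M ≥ N + p` is ample.
  obtain ⟨q, hq⟩ := exists_nat_ge (N + p)
  obtain ⟨C, hC0, hC⟩ := hm (max m q) (le_max_left _ _)
  set M := max m q
  have hqM : (q : ℝ) ≤ M := by exact_mod_cast le_max_right m q
  set c : ℝ := (4 * Real.pi) ^ (-((n : ℝ) / 2)) / j.factorial with hc
  have hc0 : 0 ≤ c := by positivity
  -- The `+ 1` guarantees positivity, `C` being only nonnegative.
  refine ⟨c * (N.factorial * (C * 4 ^ M)) + 1, by positivity, fun l hl x y hxy => ?_⟩
  set r := ‖x - y‖ with hr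
  have hr0 : 0 < r := by linarith
  set s : Set (EuclideanSpace ℝ (Fin n)) := {y | x ≠ y} with hs
  have hso : IsOpen s := isOpen_ne_fun continuous_const continuous_id
  have hys : y ∈ s := by
    intro h
    rw [hr, h, sub_self, norm_zero] at hr0
    exact lt_irrefl _ hr0
  set f : EuclideanSpace ℝ (Fin n) → ℝ := fun y => ‖x - y‖ ^ 2 / 4 with hf
  have hfs : ContDiff ℝ N f := ((contDiff_const.sub contDiff_id).norm_sq ℝ).div_const 4
  have hst : MapsTo f s (Ioi 0) := fun z hz => by
    have : 0 < ‖x - z‖ := norm_pos_iff.2 (sub_ne_zero.2 hz)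
    simp only [hf, mem_Ioi]
    positivity
  have hcomp : ContDiffOn ℝ N (besselIntegral ((j : ℝ) - n / 2) α ∘ f) s :=
    (contDiffOn_besselIntegral N _ hα).comp hfs.contDiffOn hst
  have hlN : (l : WithTop ℕ∞) ≤ N := by exact_mod_cast hl
  have h1 : iteratedFDeriv ℝ l (greenAlpha n (j + 1) α x) y =
      c • iteratedFDerivWithin ℝ l (besselIntegral ((j : ℝ) - n / 2) α ∘ f) s y := by
    rw [← iteratedFDerivWithin_of_isOpen l hso hys,
      ← iteratedFDerivWithin_const_smul_apply ((hcomp.of_le hlN) y hys) hso.uniqueDiffOn hys]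
    refine iteratedFDerivWithin_congr (fun z hz => ?_) hys l
    rw [greenAlpha_eq_greenRadial j hα hz, greenRadial_eq]
    rfl
  have h2 := norm_iteratedFDerivWithin_comp_le (contDiffOn_besselIntegral N ((j : ℝ) - n / 2) hα)
    hfs.contDiffOn hlN (uniqueDiffOn_Ioi 0) hso.uniqueDiffOn hst hys
    (C := C / f y ^ M) (D := r) (fun i hi => hC i (hi.trans hl) (f y) (hst hys))
    (fun i hi _ => by
      rw [iteratedFDerivWithin_of_isOpen i hso hys]
      exact norm_iteratedFDeriv_norm_sub_sq_div_four_le x y hxy i hi)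
  have h3 : (r ^ 2) ^ M ≥ r ^ N * r ^ p := by
    rw [← pow_mul, ← Real.rpow_natCast, ← Real.rpow_natCast, ← Real.rpow_add hr0]
    refine Real.rpow_le_rpow_of_exponent_le hxy ?_
    push_cast
    have : (0 : ℝ) ≤ M := by positivity
    linarith
  have h4 : C / f y ^ M * r ^ N ≤ C * 4 ^ M * r ^ (-p) := by
    rw [Real.rpow_neg hr0.le]
    simp only [hf]
    rw [div_pow, ← hr, div_div_eq_mul_div, div_mul_eq_mul_div, ← div_eq_mul_inv,
      div_le_div_iff₀ (by positivity) (by positivity), mul_assoc]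
    gcongr
  have hCf : 0 ≤ C / f y ^ M := div_nonneg hC0 (pow_nonneg (le_of_lt (hst hys)) _)
  rw [h1, norm_smul, Real.norm_of_nonneg hc0]
  calc _ ≤ c * (l.factorial * (C / f y ^ M) * r ^ l) := by gcongr
    _ ≤ c * (N.factorial * (C / f y ^ M) * r ^ N) := by
      gcongr
    _ = c * (N.factorial * (C / f y ^ M * r ^ N)) := by ring
    _ ≤ c * (N.factorial * (C * 4 ^ M * r ^ (-p))) := by gcongr
    _ ≤ (c * (N.factorial * (C * 4 ^ M)) + 1) * r ^ (-p) := by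
      have : 0 ≤ r ^ (-p) := by positivity
      linarith

theorem greenAlpha_inClassH (n j : ℕ) (hn : 2 * (j + 1) < n) {α : ℝ} (hα : 0 < α) :
    InClassH (n := n) (j + 1) (greenAlpha n (j + 1) α) where
  contDiffOn := greenAlpha_contDiffOn n j _ hα
  near := by
    obtain ⟨C, hC, h⟩ := exists_greenRadial_le_rpow n j hn
    refine ⟨C, hC, fun x y hxy _ => ?_⟩
    rw [greenAlpha_eq_greenRadial j hα hxy, abs_of_nonneg (greenRadial_nonneg _ _ _ _), neg_sub]
    exact h α _ hα (norm_pos_iff.2 (sub_ne_zero.2 hxy))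
  far p _ := greenAlpha_derivatives_decay n j _ hα p

end

/-! ### Fourier analysis: the kernel is a fundamental solution. -/

section

open MeasureTheory Set Filter Topology
open scoped ENNReal SchwartzMap FourierTransform Laplacian RealInnerProductSpace

/-- The operator `Δ + α` on complex Schwartz functions. -/
noncomputable def schwartzOp {n : ℕ} (α : ℝ) (f : 𝓢(EuclideanSpace ℝ (Fin n), ℂ)) :
    𝓢(EuclideanSpace ℝ (Fin n), ℂ) :=
  -Δ f + (α : ℂ) • f

theorem fourier_schwartzOp {n : ℕ} (α : ℝ) (f : 𝓢(EuclideanSpace ℝ (Fin n), ℂ))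
    (ξ : EuclideanSpace ℝ (Fin n)) :
    𝓕 (schwartzOp α f) ξ = ((α + (2 * Real.pi) ^ 2 * ‖ξ‖ ^ 2 : ℝ) : ℂ) * 𝓕 f ξ := by
  have h : 𝓕 (Δ f) ξ = -((2 * Real.pi) ^ 2 * ‖ξ‖ ^ 2 : ℝ) * 𝓕 f ξ := by
    rw [SchwartzMap.laplacian_eq_fourierMultiplierCLM, SchwartzMap.fourierMultiplierCLM_apply,
      FourierTransform.fourier_smul, FourierTransform.fourier_fourierInv_eq, smul_apply,
      SchwartzMap.smulLeftCLM_apply_apply (by fun_prop)]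
    simp
    ring
  rw [schwartzOp, FourierTransform.fourier_add, FourierTransform.fourier_neg,
    FourierTransform.fourier_smul, add_apply, neg_apply,
    smul_apply, h]
  push_cast
  rw [smul_eq_mul]
  ring

theorem fourier_schwartzOp_iterate {n : ℕ} (α : ℝ) (k : ℕ)
    (f : 𝓢(EuclideanSpace ℝ (Fin n), ℂ)) (ξ : EuclideanSpace ℝ (Fin n)) :
    𝓕 ((schwartzOp α)^[k] f) ξ =
      ((α + (2 * Real.pi) ^ 2 * ‖ξ‖ ^ 2 : ℝ) : ℂ) ^ k * 𝓕 f ξ := by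
  induction k with
  | zero => simp
  | succ k ih => rw [Function.iterate_succ_apply', fourier_schwartzOp, ih, pow_succ']; ring

/-- Transfers the complex Schwartz calculus to real test functions. The quantifier over `f` and `φ`
stays inside because iteration applies the operator to the argument first. -/
theorem schwartzOp_iterate_eq_polyOp {n : ℕ} (α : ℝ) (k : ℕ) :
    ∀ (f : 𝓢(EuclideanSpace ℝ (Fin n), ℂ)) (φ : EuclideanSpace ℝ (Fin n) → ℝ),
      (∀ y, f y = φ y) → ∀ y, (schwartzOp α)^[k] f y = polyOp α k φ y := by
  induction k with
  | zero => intro f φ h y; exact h y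
  | succ k ih =>
    intro f φ h y
    have hφ : φ = Complex.reCLM ∘ f := by ext y; simp [h y]
    have hs : ContDiff ℝ 2 φ := by
      rw [hφ]; exact Complex.reCLM.contDiff.comp (f.smooth 2)
    have hf : (f : EuclideanSpace ℝ (Fin n) → ℂ) = Complex.ofRealCLM ∘ φ := by ext y; simp [h y]
    refine ih (schwartzOp α f) (fun y => -(Δ φ y) + α * φ y) (fun y => ?_) y
    rw [schwartzOp, add_apply, neg_apply, smul_apply,
      SchwartzMap.laplacian_apply, hf, hs.contDiffAt.laplacian_CLM_comp_left]
    simp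

/-- The heat kernel centred at `x` is the Fourier transform of a modulated Gaussian; the transform
is then moved onto `f` by its self-duality under the integral. -/
theorem integral_heatKernel_smul {n : ℕ} (f : 𝓢(EuclideanSpace ℝ (Fin n), ℂ))
    (x : EuclideanSpace ℝ (Fin n)) {t : ℝ} (ht : 0 < t) :
    ∫ y, (heatKernel n t ‖x - y‖ : ℂ) * f y =
      ∫ ξ, (Real.exp (-((2 * Real.pi) ^ 2 * ‖ξ‖ ^ 2 * t)) : ℂ) *
        (Complex.exp (2 * Real.pi * ⟪ξ, x⟫ * Complex.I) * 𝓕 f ξ) := by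
  have hb : 0 < (((2 * Real.pi) ^ 2 * t : ℝ) : ℂ).re := by
    rw [Complex.ofReal_re]; positivity
  have hint : Integrable (fun v : EuclideanSpace ℝ (Fin n) =>
      Complex.exp (-((2 * Real.pi) ^ 2 * t : ℝ) * ‖v‖ ^ 2 + 2 * Real.pi * Complex.I * ⟪x, v⟫)) := by
    have := GaussianFourier.integrable_cexp_neg_mul_sq_norm_add hb (2 * Real.pi * Complex.I) x
    simpa using this
  have h := VectorFourier.integral_fourierIntegral_smul_eq_flip (L := innerₗ _)
    (μ := (volume : Measure (EuclideanSpace ℝ (Fin n)))) (ν := volume)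
    Real.continuous_fourierChar (continuous_inner) hint f.integrable
  have e1 : ∀ w, VectorFourier.fourierIntegral Real.fourierChar volume (innerₗ _)
      (fun v : EuclideanSpace ℝ (Fin n) =>
      Complex.exp (-((2 * Real.pi) ^ 2 * t : ℝ) * ‖v‖ ^ 2 + 2 * Real.pi * Complex.I * ⟪x, v⟫)) w =
      (heatKernel n t ‖x - w‖ : ℂ) := by
    intro w
    refine (fourier_gaussian_innerProductSpace' hb x w).trans ?_
    have hk : heatKernel n t ‖x - w‖ = (Real.pi / ((2 * Real.pi) ^ 2 * t)) ^ ((n : ℝ) / 2) *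
        Real.exp (-Real.pi ^ 2 * ‖x - w‖ ^ 2 / ((2 * Real.pi) ^ 2 * t)) := by
      rw [heatKernel, Real.rpow_neg (by positivity), ← Real.inv_rpow (by positivity)]
      congr 2
      · field_simp; norm_num
      · field_simp; norm_num
    rw [hk, finrank_euclideanSpace_fin]
    push_cast
    rw [Complex.ofReal_cpow (by positivity)]
    push_cast
    rfl
  have e2 : (innerₗ (EuclideanSpace ℝ (Fin n))).flip = innerₗ _ := flip_innerₗ _
  simp_rw [e1, e2, smul_eq_mul] at h
  rw [h]
  refine integral_congr_ae (Eventually.of_forall fun ξ => ?_)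
  simp only
  rw [Complex.exp_add, mul_assoc, real_inner_comm x ξ, Complex.ofReal_exp]
  congr 2
  · push_cast; ring
  · congr 1; ring

theorem integral_pow_div_factorial_mul_exp (j : ℕ) {β : ℝ} (hβ : 0 < β) :
    ∫ t in Ioi (0 : ℝ), t ^ j / j.factorial * Real.exp (-(β * t)) = (β ^ (j + 1))⁻¹ := by
  have h := Real.integral_rpow_mul_exp_neg_mul_Ioi (a := (j : ℝ) + 1) (by positivity) hβ
  rw [add_sub_cancel_right, Real.Gamma_nat_eq_factorial] at h
  have e : ∀ t : ℝ, t ^ j / j.factorial * Real.exp (-(β * t)) =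
      (j.factorial : ℝ)⁻¹ * (t ^ (j : ℝ) * Real.exp (-(β * t))) := fun t => by
    rw [Real.rpow_natCast]; ring
  simp_rw [e]
  rw [integral_const_mul, h, ← Nat.cast_succ, Real.rpow_natCast, one_div, inv_pow]
  have : (j.factorial : ℝ) ≠ 0 := by positivity
  field_simp

theorem integrable_pow_div_factorial_mul_exp (j : ℕ) {β : ℝ} (hβ : 0 < β) :
    IntegrableOn (fun t : ℝ => t ^ j / j.factorial * Real.exp (-(β * t))) (Ioi (0 : ℝ)) := by
  refine Integrable.of_integral_ne_zero ?_
  rw [integral_pow_div_factorial_mul_exp j hβ]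
  positivity

/-- The heat kernel has mass 1 in `y`, so only the integrable weight in `t` remains. -/
theorem integrable_prod_heatKernel {n : ℕ} (j : ℕ) {α : ℝ} (hα : 0 < α)
    (x : EuclideanSpace ℝ (Fin n)) :
    Integrable (fun p : EuclideanSpace ℝ (Fin n) × ℝ =>
      p.2 ^ j / j.factorial * Real.exp (-(α * p.2)) * heatKernel n p.2 ‖x - p.1‖)
      (volume.prod (volume.restrict (Ioi 0))) := by
  rw [integrable_prod_iff' (Measurable.aestronglyMeasurable (by fun_prop))]
  constructor
  · filter_upwards [ae_restrict_mem measurableSet_Ioi] with t ht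
    exact (integral_heatKernel x ht).1.const_mul _
  · refine (integrable_pow_div_factorial_mul_exp j hα).congr ?_
    filter_upwards [ae_restrict_mem measurableSet_Ioi] with t (ht : 0 < t)
    have h : ∀ y, ‖t ^ j / j.factorial * Real.exp (-(α * t)) * heatKernel n t ‖x - y‖‖ =
        t ^ j / j.factorial * Real.exp (-(α * t)) * heatKernel n t ‖x - y‖ := fun y =>
      Real.norm_of_nonneg (mul_nonneg (by positivity) (heatKernel_nonneg n ht _))
    simp_rw [h]
    rw [integral_const_mul, (integral_heatKernel x ht).2, mul_one]

theorem integrable_greenRadial {n : ℕ} (j : ℕ) {α : ℝ} (hα : 0 < α)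
    (x : EuclideanSpace ℝ (Fin n)) :
    Integrable (fun y : EuclideanSpace ℝ (Fin n) => greenRadial n j α ‖x - y‖) :=
  (integrable_prod_heatKernel j hα x).integral_prod_left

/-- Two uses of Fubini bring the `t`-integral inside the frequency integral, where it equals
`(α+4π²|ξ|²)^{-(j+1)}` and cancels the symbol of the operator; Fourier inversion finishes. -/
theorem integral_greenRadial_schwartzOp {n : ℕ} (j : ℕ) {α : ℝ} (hα : 0 < α)
    (x : EuclideanSpace ℝ (Fin n)) (f : 𝓢(EuclideanSpace ℝ (Fin n), ℂ)) :
    ∫ y, (greenRadial n j α ‖x - y‖ : ℂ) * (schwartzOp α)^[j + 1] f y = f x := by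
  set ψ := (schwartzOp α)^[j + 1] f with hψ
  calc
    _ = ∫ y, ∫ t in Ioi (0 : ℝ), ((t ^ j / j.factorial * Real.exp (-(α * t)) *
          heatKernel n t ‖x - y‖ : ℝ) : ℂ) * ψ y := by
        refine integral_congr_ae (Eventually.of_forall fun y => ?_)
        simp only
        rw [integral_mul_const, integral_complex_ofReal, greenRadial]
    _ = ∫ t in Ioi (0 : ℝ), ∫ y, ((t ^ j / j.factorial * Real.exp (-(α * t)) *
          heatKernel n t ‖x - y‖ : ℝ) : ℂ) * ψ y := by
        refine integral_integral_swap ?_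
        obtain ⟨C, hC⟩ := ψ.decay 0 0
        refine (integrable_prod_heatKernel j hα x).ofReal.mul_bdd (c := C)
          (ψ.continuous.comp continuous_fst).aestronglyMeasurable
          (Eventually.of_forall fun p => ?_)
        simpa using hC.2 p.1
    _ = ∫ t in Ioi (0 : ℝ), ∫ ξ, ((t ^ j / j.factorial *
          Real.exp (-((α + (2 * Real.pi) ^ 2 * ‖ξ‖ ^ 2) * t)) : ℝ) : ℂ) *
        (Complex.exp (2 * Real.pi * ⟪ξ, x⟫ * Complex.I) * 𝓕 ψ ξ) := by
        refine setIntegral_congr_fun measurableSet_Ioi fun t ht => ?_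
        simp only [Complex.ofReal_mul (_ * _), mul_assoc ((_ * _ : ℝ) : ℂ)]
        rw [integral_const_mul, integral_heatKernel_smul ψ x ht, ← integral_const_mul]
        refine integral_congr_ae (Eventually.of_forall fun ξ => ?_)
        simp only
        rw [← mul_assoc, ← Complex.ofReal_mul, mul_assoc (_ / _), ← Real.exp_add]
        congr 4
        ring
    _ = ∫ ξ, ∫ t in Ioi (0 : ℝ), ((t ^ j / j.factorial *
          Real.exp (-((α + (2 * Real.pi) ^ 2 * ‖ξ‖ ^ 2) * t)) : ℝ) : ℂ) *
        (Complex.exp (2 * Real.pi * ⟪ξ, x⟫ * Complex.I) * 𝓕 ψ ξ) := by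
        refine integral_integral_swap ?_
        -- Majorant `t^j/j! e^{-αt} |𝓕 ψ(ξ)|`: the phase has modulus 1 and `e^{-4π²|ξ|²t} ≤ 1`.
        have h := (integrable_pow_div_factorial_mul_exp j hα).ofReal (𝕜 := ℂ).mul_prod
          ((𝓕 ψ : 𝓢(EuclideanSpace ℝ (Fin n), ℂ)).integrable (μ := volume))
        refine h.mono (Measurable.aestronglyMeasurable ?_) ?_
        · have : Measurable fun ξ => 𝓕 ψ ξ :=
            (𝓕 ψ : 𝓢(EuclideanSpace ℝ (Fin n), ℂ)).continuous.measurable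
          unfold Function.uncurry
          fun_prop
        · have : ∀ᵐ p : ℝ × EuclideanSpace ℝ (Fin n) ∂((volume.restrict (Ioi 0)).prod volume),
              0 < p.1 := Measure.quasiMeasurePreserving_fst.ae (ae_restrict_mem measurableSet_Ioi)
          filter_upwards [this] with p hp
          have e : (2 * Real.pi * ⟪p.2, x⟫ * Complex.I : ℂ) =
              ((2 * Real.pi * ⟪p.2, x⟫ : ℝ) : ℂ) * Complex.I := by push_cast; rfl
          simp only [Function.uncurry]
          rw [norm_mul, norm_mul, norm_mul, e, Complex.norm_exp_ofReal_mul_I, one_mul]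
          refine mul_le_mul_of_nonneg_right ?_ (norm_nonneg _)
          rw [RCLike.norm_ofReal, Complex.norm_real, Real.norm_of_nonneg (by positivity),
            abs_of_nonneg (by positivity)]
          gcongr
          have : 0 ≤ (2 * Real.pi) ^ 2 * ‖p.2‖ ^ 2 := by positivity
          linarith
    _ = ∫ ξ, Complex.exp (2 * Real.pi * ⟪ξ, x⟫ * Complex.I) • 𝓕 f ξ := by
        refine integral_congr_ae (Eventually.of_forall fun ξ => ?_)
        simp only
        have hβ : 0 < α + (2 * Real.pi) ^ 2 * ‖ξ‖ ^ 2 := by positivity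
        rw [integral_mul_const, integral_complex_ofReal, integral_pow_div_factorial_mul_exp j hβ, hψ,
          fourier_schwartzOp_iterate, smul_eq_mul]
        have : ((α + (2 * Real.pi) ^ 2 * ‖ξ‖ ^ 2 : ℝ) : ℂ) ≠ 0 := by exact_mod_cast hβ.ne'
        rw [Complex.ofReal_inv, Complex.ofReal_pow, mul_left_comm,
          inv_mul_cancel_left₀ (pow_ne_zero _ this)]
    _ = f x := by
        have h : 𝓕⁻ (𝓕 f) x = f x := by rw [FourierTransform.fourierInv_fourier_eq]
        rw [← h, SchwartzMap.fourierInv_coe, Real.fourierInv_eq']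
        simp

theorem greenAlpha_isFundamentalSolution {n : ℕ} (hn : 1 ≤ n) (j : ℕ) {α : ℝ} (hα : 0 < α) :
    IsFundamentalSolution (n := n) α (j + 1) (greenAlpha n (j + 1) α) := by
  intro x
  have : NeZero n := ⟨by omega⟩
  have hae : greenAlpha n (j + 1) α x =ᵐ[volume] fun y => greenRadial n j α ‖x - y‖ := by
    filter_upwards [Measure.ae_ne volume x] with y hy
    exact greenAlpha_eq_greenRadial j hα hy.symm
  refine ⟨((integrable_greenRadial j hα x).congr hae.symm).locallyIntegrable, fun φ hφ hc => ?_⟩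
  set f : 𝓢(EuclideanSpace ℝ (Fin n), ℂ) :=
    (hc.comp_left (g := Complex.ofRealCLM) rfl).toSchwartzMap (Complex.ofRealCLM.contDiff.comp hφ)
  have hf : ∀ y, f y = φ y := fun y => rfl
  have h := integral_greenRadial_schwartzOp j hα x f
  simp_rw [schwartzOp_iterate_eq_polyOp α (j + 1) f φ hf, hf, ← Complex.ofReal_mul] at h
  rw [integral_complex_ofReal, Complex.ofReal_inj] at h
  rw [← h]
  refine integral_congr_ae ?_
  filter_upwards [hae] with y hy
  rw [hy]

end

/-! ### Uniqueness in `𝔥_k`: testing against plane waves. -/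

section

open MeasureTheory Set Filter Topology
open scoped SchwartzMap FourierTransform Laplacian RealInnerProductSpace ContDiff

/-- A family of smooth functions whose derivatives of every order are uniformly bounded. -/
structure UniformlySmooth {ι E V : Type*} [NormedAddCommGroup E] [NormedSpace ℝ E]
    [NormedAddCommGroup V] [NormedSpace ℝ V] (F : ι → E → V) : Prop where
  contDiff : ∀ i, ContDiff ℝ ∞ (F i)
  bound : ∀ m : ℕ, ∃ C : ℝ, ∀ i y, ‖iteratedFDeriv ℝ m (F i) y‖ ≤ C

namespace UniformlySmooth

variable {ι E V W : Type*} [NormedAddCommGroup E] [NormedSpace ℝ E]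
  [NormedAddCommGroup V] [NormedSpace ℝ V] [NormedAddCommGroup W] [NormedSpace ℝ W]
  {F G : ι → E → V}

theorem of_hasCompactSupport {f : E → V} (hf : ContDiff ℝ ∞ f) (hc : HasCompactSupport f) :
    UniformlySmooth (fun _ : ι => f) where
  contDiff _ := hf
  bound m := by
    obtain ⟨C, hC⟩ := (hf.continuous_iteratedFDeriv (m := m)
      (by exact_mod_cast le_top)).bounded_above_of_compact_support (hc.iteratedFDeriv m)
    exact ⟨C, fun _ y => hC y⟩

theorem fderiv (hF : UniformlySmooth F) : UniformlySmooth fun i => fderiv ℝ (F i) where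
  contDiff i := (hF.contDiff i).fderiv_right (by simp)
  bound m := by
    obtain ⟨C, hC⟩ := hF.bound (m + 1)
    exact ⟨C, fun i y => by rw [norm_iteratedFDeriv_fderiv]; exact hC i y⟩

theorem clm_comp (hF : UniformlySmooth F) (L : V →L[ℝ] W) :
    UniformlySmooth fun i y => L (F i y) where
  contDiff i := L.contDiff.comp (hF.contDiff i)
  bound m := by
    obtain ⟨C, hC⟩ := hF.bound m
    refine ⟨‖L‖ * C, fun i y => ?_⟩
    refine (L.norm_iteratedFDeriv_comp_left (hF.contDiff i).contDiffAt
      (n := m) (by exact_mod_cast le_top)).trans ?_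
    gcongr
    exact hC i y

theorem add (hF : UniformlySmooth F) (hG : UniformlySmooth G) :
    UniformlySmooth fun i y => F i y + G i y where
  contDiff i := (hF.contDiff i).add (hG.contDiff i)
  bound m := by
    obtain ⟨C, hC⟩ := hF.bound m
    obtain ⟨C', hC'⟩ := hG.bound m
    refine ⟨C + C', fun i y => ?_⟩
    have hm : (m : WithTop ℕ∞) ≤ ∞ := by exact_mod_cast le_top
    rw [fun_iteratedFDeriv_add_apply ((hF.contDiff i).of_le hm).contDiffAt
      ((hG.contDiff i).of_le hm).contDiffAt]
    exact (norm_add_le _ _).trans (add_le_add (hC i y) (hC' i y))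

theorem comp_clm {E' : Type*} [NormedAddCommGroup E'] [NormedSpace ℝ E'] (hF : UniformlySmooth F)
    (L : ι → E' →L[ℝ] E) {K : ℝ} (hL : ∀ i, ‖L i‖ ≤ K) :
    UniformlySmooth fun i y => F i (L i y) where
  contDiff i := (hF.contDiff i).comp (L i).contDiff
  bound m := by
    obtain ⟨C, hC⟩ := hF.bound m
    refine ⟨C * K ^ m, fun i y => ?_⟩
    have h : iteratedFDeriv ℝ m (fun y => F i (L i y)) y = _ :=
      (L i).iteratedFDeriv_comp_right (hF.contDiff i) y (i := m) (by exact_mod_cast le_top)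
    rw [h]
    refine (ContinuousMultilinearMap.norm_compContinuousLinearMap_le _ _).trans ?_
    rw [Finset.prod_const, Finset.card_univ, Fintype.card_fin]
    have hC0 := (norm_nonneg _).trans (hC i (L i y))
    gcongr
    · exact hC i _
    · exact hL i

theorem mul {F G : ι → E → ℝ} (hF : UniformlySmooth F) (hG : UniformlySmooth G) :
    UniformlySmooth fun i y => F i y * G i y where
  contDiff i := (hF.contDiff i).mul (hG.contDiff i)
  bound m := by
    choose C hC using hF.bound
    choose C' hC' using hG.bound
    refine ⟨∑ k ∈ Finset.range (m + 1), (m.choose k : ℝ) * C k * C' (m - k), fun i y => ?_⟩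
    refine (norm_iteratedFDeriv_mul_le (hF.contDiff i) (hG.contDiff i) y
      (n := m) (by exact_mod_cast le_top)).trans ?_
    refine Finset.sum_le_sum fun k _ => ?_
    have := (norm_nonneg _).trans (hC k i y)
    gcongr
    · exact hC k i y
    · exact hC' _ i y

end UniformlySmooth

section Laplacian

variable {E : Type*} [NormedAddCommGroup E] [InnerProductSpace ℝ E] [FiniteDimensional ℝ E]

theorem UniformlySmooth.laplacian {ι : Type*} {F : ι → E → ℝ} (hF : UniformlySmooth F) :
    UniformlySmooth fun i => Δ (F i) := by
  let e := stdOrthonormalBasis ℝ E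
  let L : (E →L[ℝ] E →L[ℝ] ℝ) →L[ℝ] ℝ :=
    ∑ i, (ContinuousLinearMap.apply ℝ ℝ (e i)).comp (ContinuousLinearMap.apply ℝ (E →L[ℝ] ℝ) (e i))
  convert! hF.fderiv.fderiv.clm_comp L using 3 with i y
  rw [InnerProductSpace.laplacian_eq_iteratedFDeriv_stdOrthonormalBasis]
  simp [L, e, iteratedFDeriv_two_apply]

theorem laplacian_comp_inner {g g' g'' : ℝ → ℝ} (h : ∀ s, HasDerivAt g (g' s) s)
    (h' : ∀ s, HasDerivAt g' (g'' s) s) (w y : E) :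
    Δ (fun y => g (innerSL ℝ w y)) y = ‖w‖ ^ 2 * g'' (innerSL ℝ w y) := by
  have h1 : fderiv ℝ (fun y => g (innerSL ℝ w y)) = fun y => g' (innerSL ℝ w y) • innerSL ℝ w := by
    funext y
    exact ((h _).comp_hasFDerivAt y (innerSL ℝ w).hasFDerivAt).fderiv
  have h2 : fderiv ℝ (fun y => g' (innerSL ℝ w y) • innerSL ℝ w) y =
      (g'' (innerSL ℝ w y) • innerSL ℝ w).smulRight (innerSL ℝ w) := by
    have h3 : HasFDerivAt (fun y => g' (innerSL ℝ w y)) (g'' (innerSL ℝ w y) • innerSL ℝ w) y :=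
      (h' _).comp_hasFDerivAt y (innerSL ℝ w).hasFDerivAt
    exact (h3.smul_const (innerSL ℝ w : E →L[ℝ] ℝ)).fderiv
  rw [InnerProductSpace.laplacian_eq_iteratedFDeriv_stdOrthonormalBasis]
  simp only [iteratedFDeriv_two_apply, h1, h2]
  rw [← (stdOrthonormalBasis ℝ E).sum_sq_inner_left w, Finset.sum_mul]
  refine Finset.sum_congr rfl fun i _ => ?_
  simp
  ring

end Laplacian

variable {n : ℕ}

theorem UniformlySmooth.polyOp {ι : Type*} (α : ℝ) (k : ℕ) :
    ∀ {F : ι → EuclideanSpace ℝ (Fin n) → ℝ}, UniformlySmooth F →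
      UniformlySmooth fun i => polyOp α k (F i) := by
  induction k with
  | zero => intro F hF; exact hF
  | succ k ih =>
    intro F hF
    refine ih (F := fun i y => -(Δ (F i) y) + α * F i y) ?_
    have h1 := hF.laplacian.clm_comp (-ContinuousLinearMap.id ℝ ℝ)
    have h2 := hF.clm_comp (α • ContinuousLinearMap.id ℝ ℝ)
    simpa using h1.add h2

/-- Locality of the operator, stated for germs so that it can be iterated. It removes the cutoff
where the cutoff equals 1. -/
theorem polyOp_eventuallyEq (α : ℝ) (k : ℕ) {y : EuclideanSpace ℝ (Fin n)} :
    ∀ {f g : EuclideanSpace ℝ (Fin n) → ℝ}, f =ᶠ[𝓝 y] g → polyOp α k f =ᶠ[𝓝 y] polyOp α k g := by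
  induction k with
  | zero => intro f g h; exact h
  | succ k ih =>
    intro f g h
    refine ih ?_
    filter_upwards [h.eventuallyEq_nhds] with z hz
    rw [InnerProductSpace.laplacian_congr_nhds hz |>.eq_of_nhds, hz.eq_of_nhds]

theorem polyOp_eigenfunction (α c : ℝ) {f : EuclideanSpace ℝ (Fin n) → ℝ} (hf : ContDiff ℝ 2 f)
    (h : ∀ y, -(Δ f y) + α * f y = c * f y) (k : ℕ) : polyOp α k f = fun y => c ^ k * f y := by
  induction k with
  | zero => funext y; simp [polyOp]
  | succ k ih =>
    rw [polyOp, Function.iterate_succ_apply']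
    rw [polyOp] at ih
    rw [ih]
    funext y
    have := InnerProductSpace.laplacian_smul (c ^ k) (hf.contDiffAt (x := y))
    have e : (fun y => c ^ k * f y) = c ^ k • f := rfl
    rw [e, this, pow_succ, smul_eq_mul, mul_assoc, ← h y, Pi.smul_apply, smul_eq_mul]
    ring

theorem abs_iteratedDeriv_cos_sin_le (m : ℕ) (s : ℝ) :
    |iteratedDeriv m Real.cos s| ≤ 1 ∧ |iteratedDeriv m Real.sin s| ≤ 1 := by
  induction m with
  | zero => simpa using ⟨Real.abs_cos_le_one s, Real.abs_sin_le_one s⟩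
  | succ m ih =>
    rw [Real.iteratedDeriv_add_one_cos, Real.iteratedDeriv_add_one_sin, Pi.neg_apply, abs_neg]
    exact ⟨ih.2, ih.1⟩

theorem uniformlySmooth_cos {ι : Type*} : UniformlySmooth (fun _ : ι => Real.cos) where
  contDiff _ := Real.contDiff_cos
  bound m := ⟨1, fun _ y => by
    rw [norm_iteratedFDeriv_eq_norm_iteratedDeriv]; exact (abs_iteratedDeriv_cos_sin_le m y).1⟩

theorem uniformlySmooth_sin {ι : Type*} : UniformlySmooth (fun _ : ι => Real.sin) where
  contDiff _ := Real.contDiff_sin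
  bound m := ⟨1, fun _ y => by
    rw [norm_iteratedFDeriv_eq_norm_iteratedDeriv]; exact (abs_iteratedDeriv_cos_sin_le m y).2⟩

/-- An integrable distributional solution may be tested against smooth functions with bounded
derivatives. -/
theorem integral_mul_polyOp_eq_zero {α : ℝ} {k : ℕ} {D : EuclideanSpace ℝ (Fin n) → ℝ}
    (hD : Integrable D)
    (h : ∀ φ : EuclideanSpace ℝ (Fin n) → ℝ, ContDiff ℝ ∞ φ → HasCompactSupport φ →
      ∫ y, D y * polyOp α k φ y = 0)
    {f : EuclideanSpace ℝ (Fin n) → ℝ} (hf : UniformlySmooth (fun _ : ℕ => f)) :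
    ∫ y, D y * polyOp α k f y = 0 := by
  let χ : ContDiffBump (0 : EuclideanSpace ℝ (Fin n)) := ⟨1, 2, one_pos, one_lt_two⟩
  -- The cutoffs `χ(y/(i+1))` exhaust the space. Since the dilations have norm at most 1, all
  -- derivatives stay bounded uniformly in `i`, so a constant times `|D|` dominates.
  let L : ℕ → EuclideanSpace ℝ (Fin n) →L[ℝ] EuclideanSpace ℝ (Fin n) := fun i =>
    ((i : ℝ) + 1)⁻¹ • ContinuousLinearMap.id ℝ _
  have hL : ∀ i, ‖L i‖ ≤ 1 := fun i => by
    refine (ContinuousLinearMap.opNorm_smul_le _ _).trans ?_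
    rw [Real.norm_of_nonneg (by positivity)]
    refine mul_le_one₀ ?_ (norm_nonneg _) ContinuousLinearMap.norm_id_le
    rw [inv_le_one₀ (by positivity)]
    have : (0 : ℝ) ≤ i := by positivity
    linarith
  have hχ : UniformlySmooth (fun (i : ℕ) y => χ (L i y)) :=
    (UniformlySmooth.of_hasCompactSupport χ.contDiff χ.hasCompactSupport).comp_clm L hL
  have hF := hχ.mul hf
  have hP := hF.polyOp α k
  obtain ⟨C, hC⟩ := hP.bound 0
  have hlim : Tendsto (fun i : ℕ => ∫ y, D y * polyOp α k (fun y => χ (L i y) * f y) y) atTop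
      (𝓝 (∫ y, D y * polyOp α k f y)) := by
    refine tendsto_integral_of_dominated_convergence (fun y => ‖D y‖ * C) (fun i => ?_)
      (hD.norm.mul_const C) (fun i => Eventually.of_forall fun y => ?_)
      (Eventually.of_forall fun y => ?_)
    · exact hD.aestronglyMeasurable.mul (hP.contDiff i).continuous.aestronglyMeasurable
    · rw [norm_mul]
      gcongr
      simpa using hC i y
    -- Near a fixed `y` the cutoff is identically 1 for large `i`, so the sequence is eventually
    -- constant.
    · refine tendsto_const_nhds.congr' ?_
      obtain ⟨N, hN⟩ := exists_nat_gt ‖y‖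
      filter_upwards [eventually_ge_atTop N] with i hi
      congr 1
      refine (polyOp_eventuallyEq α k ?_).eq_of_nhds
      have : ∀ᶠ z in 𝓝 y, ‖z‖ < N := (continuous_norm.tendsto y).eventually_lt_const hN
      filter_upwards [this] with z hz
      have hi' : (N : ℝ) ≤ i := by exact_mod_cast hi
      rw [χ.one_of_mem_closedBall, one_mul]
      rw [mem_closedBall_zero_iff]
      change ‖((i : ℝ) + 1)⁻¹ • z‖ ≤ 1
      rw [norm_smul, Real.norm_of_nonneg (by positivity), inv_mul_le_one₀ (by positivity)]
      linarith
  refine tendsto_nhds_unique hlim ?_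
  have h0 : ∀ i : ℕ, ∫ y, D y * polyOp α k (fun y => χ (L i y) * f y) y = 0 := fun i => by
    refine h _ (hF.contDiff i) (HasCompactSupport.mul_right ?_)
    refine χ.hasCompactSupport.comp_homeomorph
      (Homeomorph.smulOfNeZero ((i : ℝ) + 1)⁻¹ (by positivity))
  simp_rw [h0]
  exact tendsto_const_nhds

/-- An integrable solution of `(Δ + α)^k D = 0` on the whole space vanishes at its points of
continuity. -/
theorem eq_zero_of_integral_mul_polyOp_eq_zero {α : ℝ} (hα : 0 < α) {k : ℕ}
    {D : EuclideanSpace ℝ (Fin n) → ℝ} (hD : Integrable D)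
    (h : ∀ φ : EuclideanSpace ℝ (Fin n) → ℝ, ContDiff ℝ ∞ φ → HasCompactSupport φ →
      ∫ y, D y * polyOp α k φ y = 0) {y : EuclideanSpace ℝ (Fin n)} (hy : ContinuousAt D y) :
    D y = 0 := by
  have key : ∀ (w : EuclideanSpace ℝ (Fin n)) (f : EuclideanSpace ℝ (Fin n) → ℝ),
      UniformlySmooth (fun _ : ℕ => f) → (∀ y, Δ f y = -(‖w‖ ^ 2 * f y)) →
      ∫ y, D y * f y = 0 := by
    intro w f hf hw
    have h1 := integral_mul_polyOp_eq_zero hD h hf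
    rw [polyOp_eigenfunction α (‖w‖ ^ 2 + α) ((hf.contDiff 0).of_le
      (WithTop.coe_le_coe.2 (le_top : (2 : ℕ∞) ≤ ⊤))) (fun y => by rw [hw]; ring)] at h1
    simp_rw [mul_left_comm (D _)] at h1
    rw [integral_const_mul] at h1
    -- Because `α > 0`, the eigenvalue `(‖w‖² + α)^k` is nonzero even at `w = 0`.
    exact (mul_eq_zero.1 h1).resolve_left (by positivity)
  have hcos : ∀ w : EuclideanSpace ℝ (Fin n), ∫ y, D y * Real.cos (innerSL ℝ w y) = 0 := fun w =>
    key w _ (uniformlySmooth_cos.comp_clm (fun _ => innerSL ℝ w) (fun _ => le_rfl)) fun y => by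
      rw [laplacian_comp_inner Real.hasDerivAt_cos fun s => (Real.hasDerivAt_sin s).neg]
      ring
  have hsin : ∀ w : EuclideanSpace ℝ (Fin n), ∫ y, D y * Real.sin (innerSL ℝ w y) = 0 := fun w =>
    key w _ (uniformlySmooth_sin.comp_clm (fun _ => innerSL ℝ w) (fun _ => le_rfl)) fun y => by
      rw [laplacian_comp_inner Real.hasDerivAt_sin Real.hasDerivAt_cos]
      ring
  have hF : 𝓕 (fun y => (D y : ℂ)) = 0 := by
    funext ξ
    have e : ∀ y, Complex.exp (((-2 * Real.pi * ⟪y, ξ⟫ : ℝ) : ℂ) * Complex.I) • (D y : ℂ) =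
        ((D y * Real.cos (innerSL ℝ (-(2 * Real.pi) • ξ) y) : ℝ) : ℂ) +
          ((D y * Real.sin (innerSL ℝ (-(2 * Real.pi) • ξ) y) : ℝ) : ℂ) * Complex.I := by
      intro y
      have : innerSL ℝ (-(2 * Real.pi) • ξ) y = -2 * Real.pi * ⟪y, ξ⟫ := by
        rw [innerSL_apply_apply, inner_smul_left, real_inner_comm]
        simp
      rw [this, Complex.exp_mul_I, smul_eq_mul]
      push_cast
      ring
    have hi : ∀ g : ℝ → ℝ, Continuous g → (∀ s, |g s| ≤ 1) → ∀ w : EuclideanSpace ℝ (Fin n),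
        Integrable fun y => D y * g (innerSL ℝ w y) := fun g hg hb w =>
      hD.mul_bdd (c := 1) (hg.comp (innerSL ℝ w).continuous).aestronglyMeasurable
        (Eventually.of_forall fun y => hb _)
    rw [Real.fourier_eq']
    simp_rw [e]
    rw [integral_add (hi _ Real.continuous_cos Real.abs_cos_le_one _).ofReal
      ((hi _ Real.continuous_sin Real.abs_sin_le_one _).ofReal.mul_const _), integral_mul_const,
      integral_complex_ofReal, integral_complex_ofReal, hcos, hsin]
    simp
  have h2 := Integrable.fourierInv_fourier_eq (f := fun y => (D y : ℂ)) (v := y) hD.ofReal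
    (by rw [hF]; exact integrable_zero _ _ _) (Complex.continuous_ofReal.continuousAt.comp hy)
  rw [hF, Real.fourierInv_eq'] at h2
  simpa using h2.symm

/-- Local integrability handles the unit ball about `x`; outside it the decay of order `n + 1` is
integrable. -/
theorem InClassH.integrable {k : ℕ}
    {u : EuclideanSpace ℝ (Fin n) → EuclideanSpace ℝ (Fin n) → ℝ} (hu : InClassH k u)
    (x : EuclideanSpace ℝ (Fin n)) (hloc : LocallyIntegrable (u x)) : Integrable (u x) := by
  obtain ⟨C, hC, h⟩ := hu.far (n + 1) (by simp)
  have h1 : IntegrableOn (u x) (Metric.closedBall x 1) :=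
    hloc.integrableOn_isCompact (isCompact_closedBall x 1)
  have h2 : IntegrableOn (u x) (Metric.closedBall x 1)ᶜ := by
    have hg : Integrable fun y : EuclideanSpace ℝ (Fin n) => (1 + ‖y‖) ^ (-((n : ℝ) + 1)) :=
      integrable_one_add_norm (by simp)
    -- The factor `2 ^ (n + 1)` comes from `1 + ‖x - y‖ ≤ 2‖x - y‖`.
    refine Integrable.mono' (((hg.comp_sub_left x).const_mul (C * 2 ^ ((n : ℝ) + 1))).integrableOn)
      hloc.aestronglyMeasurable.restrict ?_
    filter_upwards [ae_restrict_mem measurableSet_closedBall.compl] with y hy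
    have hy' : 1 ≤ ‖x - y‖ := by
      rw [mem_compl_iff, Metric.mem_closedBall, dist_comm, dist_eq_norm, not_le] at hy
      exact hy.le
    have h3 := h 0 (by omega) x y hy'
    rw [norm_iteratedFDeriv_zero] at h3
    refine h3.trans ?_
    rw [mul_assoc]
    gcongr
    rw [Real.rpow_neg (by positivity), Real.rpow_neg (by positivity), ← div_eq_mul_inv,
      ← Real.inv_rpow (by positivity), ← Real.div_rpow (by positivity) (by positivity)]
    refine Real.rpow_le_rpow (by positivity) ?_ (by positivity)
    rw [inv_eq_one_div, div_le_div_iff₀ (by positivity) (by positivity)]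
    linarith
  rw [← integrableOn_univ, ← union_compl_self (Metric.closedBall x 1)]
  exact h1.union h2

theorem InClassH.continuousAt {k : ℕ}
    {u : EuclideanSpace ℝ (Fin n) → EuclideanSpace ℝ (Fin n) → ℝ} (hu : InClassH k u)
    {x y : EuclideanSpace ℝ (Fin n)} (hxy : x ≠ y) : ContinuousAt (u x) y := by
  have ho : IsOpen {p : EuclideanSpace ℝ (Fin n) × EuclideanSpace ℝ (Fin n) | p.1 ≠ p.2} :=
    isOpen_ne_fun continuous_fst continuous_snd
  have h := hu.contDiffOn.continuousOn.continuousAt (ho.mem_nhds (show (x, y) ∈ _ from hxy))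
  exact h.comp (f := fun y => (x, y)) (Continuous.prodMk_right x).continuousAt

/-- Fundamental solutions are unique in the class `𝔥_k`. -/
theorem IsFundamentalSolution.eq_of_inClassH {α : ℝ} (hα : 0 < α) {k : ℕ}
    {G H : EuclideanSpace ℝ (Fin n) → EuclideanSpace ℝ (Fin n) → ℝ}
    (hG : IsFundamentalSolution α k G) (hG' : InClassH k G)
    (hH : IsFundamentalSolution α k H) (hH' : InClassH k H)
    {x y : EuclideanSpace ℝ (Fin n)} (hxy : x ≠ y) : H x y = G x y := by
  have iG := hG'.integrable x (hG x).1
  have iH := hH'.integrable x (hH x).1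
  refine sub_eq_zero.1 (eq_zero_of_integral_mul_polyOp_eq_zero (k := k)
    (D := fun y => H x y - G x y) hα (iH.sub iG)
    (fun φ hφ hc => ?_) ((hH'.continuousAt hxy).sub (hG'.continuousAt hxy)))
  have hP := (UniformlySmooth.of_hasCompactSupport (ι := Unit) hφ hc).polyOp α k
  obtain ⟨C, hC⟩ := hP.bound 0
  have hb : ∀ {D : EuclideanSpace ℝ (Fin n) → ℝ}, Integrable D →
      Integrable fun y => D y * polyOp α k φ y := fun hD =>
    hD.mul_bdd (c := C) (hP.contDiff ()).continuous.aestronglyMeasurable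
      (Eventually.of_forall fun y => by simpa using hC () y)
  simp_rw [sub_mul]
  rw [integral_sub (hb iH) (hb iG), (hH x).2 φ hφ hc, (hG x).2 φ hφ hc, sub_self]

end

theorem theorem2p6 (n k : ℕ) (hk : 1 ≤ k) (hn : 2 * k < n) :
    -- the integrals defining the iterated convolutions up to order `k` converge absolutely
    (∀ j : ℕ, 1 ≤ j → j < k → ∀ x y : EuclideanSpace ℝ (Fin n), x ≠ y →
      MeasureTheory.Integrable (fun z => greenOne n j x z * greenOne n 1 z y)) ∧
    -- existence and uniqueness in the class
    (∀ α : ℝ, 0 < α →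
      IsFundamentalSolution α k (greenAlpha n k α) ∧
      InClassH k (greenAlpha n k α) ∧
      ∀ H : EuclideanSpace ℝ (Fin n) → EuclideanSpace ℝ (Fin n) → ℝ,
        IsFundamentalSolution α k H → InClassH k H →
        ∀ x y : EuclideanSpace ℝ (Fin n), x ≠ y → H x y = greenAlpha n k α x y) ∧
    -- bounds with a constant that does not depend on `α`
    (∃ C : ℝ, 0 < C ∧ ∀ α : ℝ, 0 < α → ∀ x y : EuclideanSpace ℝ (Fin n), x ≠ y →
      (Real.sqrt α * ‖x - y‖ ≤ 1 →
        greenAlpha n k α x y ≤ C * ‖x - y‖ ^ (2 * (k : ℝ) - (n : ℝ))) ∧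
      (1 ≤ Real.sqrt α * ‖x - y‖ →
        greenAlpha n k α x y ≤
          C * α ^ ((k : ℝ) * (((n : ℝ) - 3) / 4)) *
            ‖x - y‖ ^ ((((k : ℝ) - 2) * (n : ℝ) + (k : ℝ)) / 2) *
            Real.exp (-(Real.sqrt α * ‖x - y‖)))) ∧
    -- radiality
    (∀ α : ℝ, 0 < α → ∃ g : ℝ → ℝ, ∀ x y : EuclideanSpace ℝ (Fin n), x ≠ y →
      greenAlpha n k α x y = g ‖x - y‖) := by

  -- The shift matches the time weight `t^{k-1}/(k-1)!`.
  obtain ⟨j, rfl⟩ : ∃ j, k = j + 1 := ⟨k - 1, by omega⟩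
  refine ⟨fun i hi _ x y hxy => ?_, fun α hα => ⟨?_, ?_, fun H hH hH' x y hxy => ?_⟩, ?_,
    fun α hα => ⟨greenRadial n j α, fun x y hxy => greenAlpha_eq_greenRadial j hα hxy⟩⟩
  · obtain ⟨i, rfl⟩ : ∃ i', i = i' + 1 := ⟨i - 1, by omega⟩
    exact integrable_greenOne_mul i hxy
  · exact greenAlpha_isFundamentalSolution (by omega) j hα
  · exact greenAlpha_inClassH n j hn hα
  · exact (greenAlpha_isFundamentalSolution (by omega) j hα).eq_of_inClassH hα
      (greenAlpha_inClassH n j hn hα) hH hH' hxy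
  · obtain ⟨C₁, hC₁, h₁⟩ := exists_greenRadial_le_rpow n j hn
    obtain ⟨C₂, hC₂, h₂⟩ := exists_greenRadial_le_exp n j (by omega)
    refine ⟨max C₁ C₂, lt_max_of_lt_left hC₁, fun α hα x y hxy => ?_⟩
    have hr : 0 < ‖x - y‖ := norm_pos_iff.2 (sub_ne_zero.2 hxy)
    rw [greenAlpha_eq_greenRadial j hα hxy]
    refine ⟨fun _ => (h₁ α _ hα hr).trans ?_, fun h => (h₂ α _ hα hr h).trans ?_⟩
    · gcongr
      exact le_max_left _ _
    · gcongr
      exact le_max_right _ _
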